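/- All locally convex spaces are Hausdorff and over $\mathbb C$; "operator" means continuous linear map. Let $X$ be a locally convex space. * A set $D\subseteq X$ is capacious if for every totally bounded $S\subseteq X$ there is a finite $F\subseteq X$ with $S\subseteq D+F$. $X$ is pseudosaturated if every closed convex balanced capacious set in $X$ is a neighbourhood of zero, and pseudocomplete if every totally bounded Cauchy net in $X$ converges. * The pseudosaturation $X^\vartriangle$, with the natural map $\vartriangle_X:X^\vartriangle\to X$, is the space $X$ with the topology at which the projective series $X_\mu$ stabilizes: $X_0=X$; in $X_{\mu+1}$ the closed convex balanced capacious sets of $X_\mu$ form a base of neighbourhoods of zero; for limit $\mu$ the topology of $X_\mu$ is the supremum of the preceding ones. For an operator $\varphi:X\to Z$ its pseudosaturation $\varphi^\vartriangle:X^\vartriangle\to Z^\vartriangle$ is the operator with $\vartriangle_Z\circ\varphi^\vartriangle=\varphi\circ\vartriangle_X$. * The pseudocompletion $X^\triangledown$, with the natural map $\triangledown_X:X\to X^\triangledown$, is the subspace of the completion of $X$ (with the induced topology) at which the injective series $X^\lambda$ stabilizes: $X^0=X$; $X^{\lambda+1}$ consists of the limits in the completion of totally bounded nets in $X^\lambda$;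 $X^\lambda=\bigcup_{\iota<\lambda}X^\iota$ for limit $\lambda$. * $Y:X$ is the space of operators $X\to Y$ with the topology of uniform convergence on totally bounded subsets of $X$; $Y\oslash X=(Y:X)^\vartriangle$ and $X^\star=\mathbb C:X$. $X$ is stereotype if the natural map $X\to(X^\star)^\star$, $x\mapsto(f\mapsto f(x))$, is an isomorphism of locally convex spaces. **Theorem.** Let $X$ be a pseudosaturated and $Y$ a pseudocomplete locally convex space, and consider the operator $$(\vartriangle_Y:\triangledown_X):(Y^\vartriangle:X^\triangledown)\to(Y:X),\qquad \psi\mapsto\ \vartriangle_Y\circ\,\psi\circ\triangledown_X .$$ Then $Y^\vartriangle$ and $X^\triangledown$ are stereotype, $Y^\vartriangle\oslash X^\triangledown=(Y^\vartriangle:X^\triangledown)^\vartriangle$ and $(Y:X)^\vartriangle$ are stereotype, and the pseudosaturation $$(\vartriangle_Y:\triangledown_X)^\vartriangle:\ Y^\vartriangle\oslash X^\triangledown=(Y^\vartriangle:X^\triangledown)^\vartriangle\to(Y:X)^\vartriangle$$ is an isomorphism of locally convex (and hence of stereotype) spaces. -/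

import Mathlib

open Topology Pointwise

namespace Ster

universe u v u' v'

/-! ### Totally bounded and capacious sets -/

section Basic

variable {E : Type u} [AddCommGroup E] [TopologicalSpace E]

/-- A subset `S` of a topological vector space is totally bounded if for every neighbourhood `U` of
zero there is a finite set `F` with `S ⊆ F + U`
(see `isTotBdd_iff_totallyBounded` for the agreement with `TotallyBounded`). -/
def IsTotBdd (S : Set E) : Prop :=
  ∀ U ∈ 𝓝 (0 : E), ∃ F : Set E, F.Finite ∧ S ⊆ F + U

theorem isTotBdd_iff_totallyBounded {E : Type u} [AddCommGroup E] [UniformSpace E]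
    [IsUniformAddGroup E] (S : Set E) : IsTotBdd S ↔ TotallyBounded S := by
  rw [totallyBounded_iff_subset_finite_iUnion_nhds_zero]
  simp only [IsTotBdd, Set.iUnion_vadd_set]
  rfl

/-- A subset `D` is capacious if for every totally bounded set `S` there is a finite set `F`
with `S ⊆ D + F`. -/
def IsCapacious (D : Set E) : Prop :=
  ∀ S : Set E, IsTotBdd S → ∃ F : Set E, F.Finite ∧ S ⊆ D + F

/-- A continuous additive map sends totally bounded sets to totally bounded sets. -/
theorem IsTotBdd.image {F : Type v} [AddCommGroup F] [TopologicalSpace F]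
    {S : Set E} (hS : IsTotBdd S) (f : E →+ F) (hf : Continuous f) : IsTotBdd (f '' S) := by
  intro U hU
  have hU' : f ⁻¹' U ∈ 𝓝 (0 : E) := hf.continuousAt.preimage_mem_nhds (by simpa using hU)
  obtain ⟨A, hA, hSA⟩ := hS _ hU'
  refine ⟨f '' A, hA.image f, ?_⟩
  rintro _ ⟨x, hx, rfl⟩
  obtain ⟨y, hy, z, hz, rfl⟩ := hSA hx
  exact ⟨f y, ⟨y, hy, rfl⟩, f z, hz, by simp⟩

theorem IsTotBdd.add [IsTopologicalAddGroup E] {S T : Set E} (hS : IsTotBdd S) (hT : IsTotBdd T) :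
    IsTotBdd (S + T) := by
  intro U hU
  obtain ⟨V, hV, hVU⟩ := exists_nhds_zero_half hU
  obtain ⟨A, hA, hSA⟩ := hS V hV
  obtain ⟨B, hB, hTB⟩ := hT V hV
  refine ⟨A + B, hA.add hB, ?_⟩
  rintro _ ⟨x, hx, y, hy, rfl⟩
  obtain ⟨a, ha, z, hz, rfl⟩ := hSA hx
  obtain ⟨b, hb, w, hw, rfl⟩ := hTB hy
  exact ⟨a + b, Set.add_mem_add ha hb, z + w, hVU z hz w hw, by simp only; abel⟩

theorem isTotBdd_singleton (x : E) : IsTotBdd ({x} : Set E) := fun U hU =>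
  ⟨{x}, Set.finite_singleton x, by
    simpa using (⟨x, rfl, 0, mem_of_mem_nhds hU, by simp⟩ : x ∈ {x} + U)⟩

end Basic

/-! ### Pseudosaturated and pseudocomplete spaces -/

/-- A locally convex space is pseudosaturated if every closed convex balanced capacious set is
a neighbourhood of zero. -/
def IsPseudosaturated (E : Type u) [AddCommGroup E] [Module ℂ E] [TopologicalSpace E] : Prop :=
  ∀ D : Set E, IsClosed D → Convex ℝ D → Balanced ℂ D → IsCapacious D → D ∈ 𝓝 0

/-- A locally convex space is pseudocomplete if every totally bounded Cauchy net converges; here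
nets are replaced by filters (the Cauchy property refers to the additive uniform structure). -/
def IsPseudocomplete (E : Type u) [AddCommGroup E] [TopologicalSpace E]
    [IsTopologicalAddGroup E] : Prop :=
  letI := IsTopologicalAddGroup.rightUniformSpace E
  ∀ f : Filter E, Cauchy f → (∃ S ∈ f, IsTotBdd S) → ∃ x, f ≤ 𝓝 x

/-! ### Pseudosaturation, through the projective series -/

section Pseudosaturation

variable {E : Type u} [AddCommGroup E] [Module ℂ E]

/-- The seminorms on `(E, t)` with closed and capacious unit ball `{x | p x ≤ 1}`. -/
abbrev CapSeminorm (t : TopologicalSpace E) : Type u :=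
  {p : Seminorm ℂ E // IsClosed[t] {x | p x ≤ 1} ∧ @IsCapacious E _ t {x | p x ≤ 1}}

instance (t : TopologicalSpace E) : Nonempty (CapSeminorm t) := by
  have h : {x | (0 : Seminorm ℂ E) x ≤ 1} = Set.univ := by ext; simp
  exact ⟨0, by rw [h]; exact isClosed_univ,
    by rw [h]; exact fun S _ => ⟨{0}, Set.finite_singleton 0, by simp⟩⟩

/-- The family of all seminorms on `(E, t)` with closed and capacious unit ball. -/
def capFamily (t : TopologicalSpace E) : SeminormFamily ℂ E (CapSeminorm t) := fun p => p.1

/-- The step of the projective series: the locally convex topology whose base of neighbourhoods of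
zero consists of the closed convex balanced capacious sets of `(E, t)`. Such sets are exactly the
closed unit balls `{x | p x ≤ 1}` of the seminorms above, and the topology is given as the one
generated by these seminorms (see `hasBasis_nhds_zero_psStep` for the description through the
base of neighbourhoods of zero). -/
@[reducible]
noncomputable def psStep (t : TopologicalSpace E) : TopologicalSpace E :=
  (capFamily t).moduleFilterBasis.topology

theorem withSeminorms_psStep (t : TopologicalSpace E) :
    @WithSeminorms ℂ E _ _ _ _ (capFamily t) (psStep t) :=
  letI := psStep t
  ⟨rfl⟩

/-- The projective series `E_μ` of `(E, t)`: `E_0 = E`, `E_{μ+1}` is obtained from `E_μ` by the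
step above, and at a limit ordinal one takes the supremum of the previous topologies
(`⨅` in Mathlib's order, where finer topologies are smaller). -/
@[reducible]
noncomputable def projSeries (t : TopologicalSpace E) (μ : Ordinal.{u}) : TopologicalSpace E :=
  Ordinal.limitRecOn μ t (fun _ s => psStep s) (fun o _ s => ⨅ κ : Set.Iio o, s κ.1 κ.2)

theorem projSeries_zero (t : TopologicalSpace E) : projSeries t 0 = t :=
  Ordinal.limitRecOn_zero ..

theorem projSeries_add_one (t : TopologicalSpace E) (μ : Ordinal.{u}) :
    projSeries t (μ + 1) = psStep (projSeries t μ) :=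
  Ordinal.limitRecOn_add_one ..

theorem projSeries_limit (t : TopologicalSpace E) (μ : Ordinal.{u}) (h : Order.IsSuccLimit μ) :
    projSeries t μ = ⨅ κ : Set.Iio μ, projSeries t κ :=
  Ordinal.limitRecOn_limit (motive := fun _ => TopologicalSpace E) (h := h) ..

/-- The topology of the pseudosaturation: the common value of `E_μ` for all sufficiently large `μ`
(the series is decreasing in Mathlib's order, so this is its infimum). -/
@[reducible]
noncomputable def psTopology (t : TopologicalSpace E) : TopologicalSpace E :=
  ⨅ μ : Ordinal.{u}, projSeries t μ

theorem psTopology_le (t : TopologicalSpace E) : psTopology t ≤ t :=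
  (iInf_le _ 0).trans (projSeries_zero t).le

/-- `t` is a locally convex vector topology. -/
def IsLC (t : TopologicalSpace E) : Prop :=
  IsTopologicalAddGroup E ∧ ContinuousSMul ℂ E ∧ LocallyConvexSpace ℝ E

theorem IsLC.iInf {ι : Sort*} {t : ι → TopologicalSpace E} (h : ∀ i, IsLC (t i)) :
    IsLC (⨅ i, t i) :=
  ⟨topologicalAddGroup_iInf fun i => (h i).1, continuousSMul_iInf fun i => (h i).2.1,
    LocallyConvexSpace.iInf fun i => (h i).2.2⟩

theorem IsLC.psStep (t : TopologicalSpace E) : IsLC (psStep t) :=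
  letI := Ster.psStep t
  have h := withSeminorms_psStep t
  ⟨h.topologicalAddGroup, h.continuousSMul, h.toLocallyConvexSpace⟩

theorem IsLC.projSeries {t : TopologicalSpace E} (h : IsLC t) (μ : Ordinal.{u}) :
    IsLC (projSeries t μ) := by
  induction μ using Ordinal.limitRecOn with
  | zero => rwa [projSeries_zero]
  | add_one μ _ => rw [projSeries_add_one]; exact IsLC.psStep _
  | limit μ hμ ih => rw [projSeries_limit t μ hμ]; exact IsLC.iInf fun κ => ih κ.1 κ.2

theorem IsLC.psTopology {t : TopologicalSpace E} (h : IsLC t) : IsLC (psTopology t) :=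
  IsLC.iInf h.projSeries

end Pseudosaturation

/-- The pseudosaturation of a locally convex space `E`: the space `E` with the topology at which
the projective series of `E` stabilizes. -/
def PsSat (E : Type u) : Type u := E

namespace PsSat

variable (E : Type u) [AddCommGroup E] [Module ℂ E] [t : TopologicalSpace E]

instance : AddCommGroup (PsSat E) := inferInstanceAs (AddCommGroup E)

instance : Module ℂ (PsSat E) := inferInstanceAs (Module ℂ E)

noncomputable instance instTopologicalSpace : TopologicalSpace (PsSat E) := psTopology (E := E) t

section LC

variable [h1 : IsTopologicalAddGroup E] [h2 : ContinuousSMul ℂ E] [h3 : LocallyConvexSpace ℝ E]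

instance : IsTopologicalAddGroup (PsSat E) := (IsLC.psTopology (E := E) ⟨h1, h2, h3⟩).1

instance : ContinuousSMul ℂ (PsSat E) := (IsLC.psTopology (E := E) ⟨h1, h2, h3⟩).2.1

instance : LocallyConvexSpace ℝ (PsSat E) := (IsLC.psTopology (E := E) ⟨h1, h2, h3⟩).2.2

end LC

/-- The natural map from the pseudosaturation of `E` to `E` (the identity of the set `E`). -/
def toBase : PsSat E →L[ℂ] E where
  toLinearMap := (LinearMap.id : E →ₗ[ℂ] E)
  cont := continuous_id_of_le (psTopology_le (E := E) t)

end PsSat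

/-! ### The step of the projective series -/

section StepLemmas

variable {E : Type u} [AddCommGroup E] [Module ℂ E]

theorem IsTotBdd.smul [TopologicalSpace E] [ContinuousConstSMul ℂ E] {S : Set E}
    (hS : IsTotBdd S) (c : ℂ) : IsTotBdd (c • S) :=
  hS.image (DistribSMul.toAddMonoidHom E c) (continuous_const_smul c)

theorem exists_finite_of_capacious [TopologicalSpace E] [ContinuousConstSMul ℂ E]
    {p : Seminorm ℂ E} (hp : IsCapacious {x | p x ≤ 1}) {S : Set E} (hS : IsTotBdd S)
    {ε : ℝ} (hε : 0 < ε) : ∃ F : Set E, F.Finite ∧ ∀ x ∈ S, ∃ y ∈ F, p (x - y) ≤ ε := by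
  have hε' : (ε : ℂ) ≠ 0 := by exact_mod_cast hε.ne'
  obtain ⟨F, hF, hSF⟩ := hp _ (hS.smul ((ε : ℂ)⁻¹))
  refine ⟨(ε : ℂ) • F, hF.smul_set, fun x hx => ?_⟩
  obtain ⟨d, hd, y, hy, hdy⟩ := hSF ⟨x, hx, rfl⟩
  refine ⟨(ε : ℂ) • y, ⟨y, hy, rfl⟩, ?_⟩
  have h1 : x - (ε : ℂ) • y = (ε : ℂ) • d := by
    have : x = (ε : ℂ) • (d + y) := by
      rw [show d + y = (ε : ℂ)⁻¹ • x from hdy, smul_inv_smul₀ hε']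
    rw [this, smul_add, add_sub_cancel_right]
  rw [h1, map_smul_eq_mul, Complex.norm_real, Real.norm_of_nonneg hε.le]
  exact mul_le_of_le_one_right hε.le hd

theorem capacious_of_exists_finite [TopologicalSpace E] {p : Seminorm ℂ E}
    (h : ∀ S : Set E, IsTotBdd S → ∃ F : Set E, F.Finite ∧ ∀ x ∈ S, ∃ y ∈ F, p (x - y) ≤ 1) :
    IsCapacious {x | p x ≤ 1} := by
  intro S hS
  obtain ⟨F, hF, hSF⟩ := h S hS
  refine ⟨F, hF, fun x hx => ?_⟩
  obtain ⟨y, hy, hxy⟩ := hSF x hx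
  exact ⟨x - y, hxy, y, hy, sub_add_cancel x y⟩

theorem capacious_sup [TopologicalSpace E] [ContinuousConstSMul ℂ E] {p q : Seminorm ℂ E}
    (hp : IsCapacious {x | p x ≤ 1}) (hq : IsCapacious {x | q x ≤ 1}) :
    IsCapacious {x | (p ⊔ q) x ≤ 1} := by
  classical
  refine capacious_of_exists_finite fun S hS => ?_
  obtain ⟨A, hA, hSA⟩ := exists_finite_of_capacious hp hS (ε := 1 / 2) (by norm_num)
  obtain ⟨B, hB, hSB⟩ := exists_finite_of_capacious hq hS (ε := 1 / 2) (by norm_num)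
  let c : E × E → E := fun ab =>
    if h : ∃ x, p (x - ab.1) ≤ 1 / 2 ∧ q (x - ab.2) ≤ 1 / 2 then h.choose else 0
  refine ⟨c '' (A ×ˢ B), (hA.prod hB).image c, fun x hx => ?_⟩
  obtain ⟨a, ha, hxa⟩ := hSA x hx
  obtain ⟨b, hb, hxb⟩ := hSB x hx
  refine ⟨c (a, b), ⟨(a, b), ⟨ha, hb⟩, rfl⟩, ?_⟩
  have h : ∃ x, p (x - (a, b).1) ≤ 1 / 2 ∧ q (x - (a, b).2) ≤ 1 / 2 := ⟨x, hxa, hxb⟩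
  have hc : c (a, b) = h.choose := dif_pos h
  have hc1 : p (c (a, b) - a) ≤ 1 / 2 := by rw [hc]; exact h.choose_spec.1
  have hc2 : q (c (a, b) - b) ≤ 1 / 2 := by rw [hc]; exact h.choose_spec.2
  refine sup_le ?_ ?_
  · have := map_sub_le_add p (x - a) (c (a, b) - a)
    rw [sub_sub_sub_cancel_right] at this
    linarith
  · have := map_sub_le_add q (x - b) (c (a, b) - b)
    rw [sub_sub_sub_cancel_right] at this
    linarith

theorem capacious_smul [TopologicalSpace E] [ContinuousConstSMul ℂ E] {p : Seminorm ℂ E}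
    (hp : IsCapacious {x | p x ≤ 1}) (r : NNReal) : IsCapacious {x | (r • p) x ≤ 1} := by
  refine capacious_of_exists_finite fun S hS => ?_
  obtain ⟨A, hA, hSA⟩ := exists_finite_of_capacious hp hS (ε := ((r : ℝ) + 1)⁻¹) (by positivity)
  refine ⟨A, hA, fun x hx => ?_⟩
  obtain ⟨a, ha, hxa⟩ := hSA x hx
  refine ⟨a, ha, ?_⟩
  have h1 : (r • p) (x - a) = (r : ℝ) * p (x - a) := rfl
  have h2 : (r : ℝ) * p (x - a) ≤ r * ((r : ℝ) + 1)⁻¹ := by gcongr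
  have h3 : (r : ℝ) * ((r : ℝ) + 1)⁻¹ ≤ 1 := by
    rw [← div_eq_mul_inv, div_le_one (by positivity)]
    linarith
  linarith

theorem isClosed_smul_ball [TopologicalSpace E] [ContinuousConstSMul ℂ E] {p : Seminorm ℂ E}
    (hp : IsClosed {x | p x ≤ 1}) (r : NNReal) : IsClosed {x | (r • p) x ≤ 1} := by
  have : {x | (r • p) x ≤ 1} = (fun x => (r : ℂ) • x) ⁻¹' {x | p x ≤ 1} := by
    ext x
    change (r : ℝ) * p x ≤ 1 ↔ p ((r : ℂ) • x) ≤ 1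
    rw [map_smul_eq_mul]
    simp
  rw [this]
  exact hp.preimage (continuous_const_smul _)

theorem finset_sup_mem [t : TopologicalSpace E] [ContinuousConstSMul ℂ E]
    (s : Finset (CapSeminorm t)) :
    IsClosed {x | (s.sup (capFamily t)) x ≤ 1} ∧ IsCapacious {x | (s.sup (capFamily t)) x ≤ 1} := by
  classical
  induction s using Finset.induction_on with
  | empty =>
    have h : {x | ((∅ : Finset (CapSeminorm t)).sup (capFamily t)) x ≤ 1} = Set.univ := by
      ext; simp
    rw [h]
    exact ⟨isClosed_univ, fun S _ => ⟨{0}, Set.finite_singleton 0, by simp⟩⟩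
  | insert i s _ ih =>
    rw [Finset.sup_insert]
    refine ⟨?_, capacious_sup i.2.2 ih.2⟩
    have : {x | (capFamily t i ⊔ s.sup (capFamily t)) x ≤ 1} =
        {x | i.1 x ≤ 1} ∩ {x | (s.sup (capFamily t)) x ≤ 1} := by
      ext x
      change max (i.1 x) ((s.sup (capFamily t)) x) ≤ 1 ↔ _
      exact max_le_iff
    rw [this]
    exact i.2.1.inter ih.1

/-- A convex balanced capacious set is absorbing. -/
theorem absorbent_of_capacious [TopologicalSpace E] [IsTopologicalAddGroup E] [ContinuousSMul ℂ E]
    {D : Set E} (h1 : Convex ℝ D) (h2 : Balanced ℂ D) (h3 : IsCapacious D) : Absorbent ℝ D := by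
  have : ContinuousSMul ℝ E := IsScalarTower.continuousSMul ℂ
  have hb : Balanced ℝ D := by
    intro a ha
    rintro _ ⟨x, hx, rfl⟩
    have := h2 (a : ℂ) (by simpa using ha) ⟨x, hx, rfl⟩
    simpa using this
  intro x
  -- the segment from `0` to `x` is totally bounded
  let S : Set E := (fun r : ℝ => r • x) '' Set.Icc 0 1
  have hS : IsTotBdd S := by
    let : UniformSpace E := IsTopologicalAddGroup.rightUniformSpace E
    have : IsUniformAddGroup E := isUniformAddGroup_of_addCommGroup
    exact (isTotBdd_iff_totallyBounded S).2
      (isCompact_Icc.image (continuous_id.smul continuous_const)).totallyBounded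
  obtain ⟨F, hF, hSF⟩ := h3 S hS
  have hch : ∀ r : ℝ, r ∈ Set.Icc (0 : ℝ) 1 → ∃ y ∈ F, r • x - y ∈ D := by
    intro r hr
    obtain ⟨d, hd, y, hy, hdy⟩ := hSF ⟨r, hr, rfl⟩
    refine ⟨y, hy, ?_⟩
    have : d + y = r • x := hdy
    rwa [← this, add_sub_cancel_right]
  choose! f hfF hfD using hch
  obtain ⟨a, ha, b, hb', hab, hfab⟩ := (Set.Icc_infinite (zero_lt_one' ℝ)).exists_ne_map_eq_of_mapsTo
    (f := f) (t := F) hfF hF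
  have hsub : (1 / 2 : ℝ) • ((a - b) • x) ∈ D := by
    have hn : -(b • x - f b) ∈ D := by
      have := hb (-1) (by simp) ⟨_, hfD b hb', rfl⟩
      simpa using this
    have := h1 (hfD a ha) hn (a := 1 / 2) (b := 1 / 2) (by norm_num) (by norm_num) (by norm_num)
    rw [← smul_add, hfab] at this
    convert this using 2
    rw [sub_smul]
    abel
  rw [absorbs_iff_norm]
  refine ⟨(|1 / 2 * (a - b)|)⁻¹, fun c hc => ?_⟩
  have hne : (1 / 2 * (a - b)) ≠ 0 := by
    have := sub_ne_zero.2 hab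
    positivity
  have hc0 : c ≠ 0 := by
    rintro rfl
    have : 0 < (|1 / 2 * (a - b)|)⁻¹ := by positivity
    rw [norm_zero] at hc
    linarith
  rw [Set.singleton_subset_iff, Set.mem_smul_set_iff_inv_smul_mem₀ hc0]
  have hx : c⁻¹ • x = (c⁻¹ * (1 / 2 * (a - b))⁻¹) • ((1 / 2 : ℝ) • ((a - b) • x)) := by
    rw [smul_smul (1 / 2 : ℝ), smul_smul, mul_assoc, inv_mul_cancel₀ hne, mul_one]
  rw [hx]
  refine hb _ ?_ ⟨_, hsub, rfl⟩
  rw [norm_mul, norm_inv, norm_inv, Real.norm_eq_abs (1 / 2 * (a - b))]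
  have hcpos : 0 < ‖c‖ := norm_pos_iff.2 hc0
  calc ‖c‖⁻¹ * |1 / 2 * (a - b)|⁻¹ ≤ ‖c‖⁻¹ * ‖c‖ := by gcongr
    _ = 1 := inv_mul_cancel₀ hcpos.ne'

/-- Closed convex balanced capacious sets are the closed unit balls of the seminorms
of `CapSeminorm`. -/
theorem exists_capSeminorm [t : TopologicalSpace E] [IsTopologicalAddGroup E] [ContinuousSMul ℂ E]
    {D : Set E} (h0 : IsClosed D) (h1 : Convex ℝ D) (h2 : Balanced ℂ D) (h3 : IsCapacious D) :
    ∃ p : CapSeminorm t, {x | p.1 x ≤ 1} = D := by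
  have : ContinuousSMul ℝ E := IsScalarTower.continuousSMul ℂ
  have ha := absorbent_of_capacious h1 h2 h3
  have hD : {x | gaugeSeminorm h2 h1 ha x ≤ 1} = D := by
    refine Set.Subset.antisymm (fun x hx => ?_) fun x hx => gauge_le_one_of_mem hx
    have := mem_closure_of_gauge_le_one h1 (ha.zero_mem) ha hx
    rwa [h0.closure_eq] at this
  exact ⟨⟨gaugeSeminorm h2 h1 ha, by rw [hD]; exact h0, by rw [hD]; exact h3⟩, hD⟩

/-- The closed convex balanced capacious sets of a locally convex space `E` form a base of
neighbourhoods of zero for the step of the projective series. -/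
theorem hasBasis_nhds_zero_psStep [t : TopologicalSpace E] [IsTopologicalAddGroup E]
    [ContinuousSMul ℂ E] :
    (@nhds E (psStep t) 0).HasBasis
      (fun D => IsClosed D ∧ Convex ℝ D ∧ Balanced ℂ D ∧ IsCapacious D) id := by
  refine ⟨fun U => ?_⟩
  have hb := @WithSeminorms.hasBasis_zero_ball ℂ E _ _ _ _ (psStep t) _ (withSeminorms_psStep t)
  rw [hb.mem_iff]
  constructor
  · rintro ⟨⟨s, r⟩, hr, hU⟩
    have hr' : (0 : ℝ) < r := hr
    let q : Seminorm ℂ E := (NNReal.mk (2 / r) (by positivity)) • s.sup (capFamily t)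
    have hq : ∀ x, q x = 2 / r * s.sup (capFamily t) x := fun x => rfl
    refine ⟨{x | q x ≤ 1}, ⟨isClosed_smul_ball (finset_sup_mem s).1 _, ?_, ?_,
      capacious_smul (finset_sup_mem s).2 _⟩, fun x hx => hU ?_⟩
    · have := q.convex_closedBall 0 1
      simpa [Seminorm.closedBall_zero_eq] using this
    · have := q.balanced_closedBall_zero 1
      rwa [Seminorm.closedBall_zero_eq] at this
    · have hx' : 2 / r * s.sup (capFamily t) x ≤ 1 := hx
      rw [Seminorm.mem_ball_zero]
      rw [div_mul_eq_mul_div, div_le_one hr'] at hx'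
      have := apply_nonneg (s.sup (capFamily t)) x
      change s.sup (capFamily t) x < r
      linarith
  · rintro ⟨D, ⟨h0, h1, h2, h3⟩, hDU⟩
    obtain ⟨p, rfl⟩ := exists_capSeminorm h0 h1 h2 h3
    refine ⟨({p}, 1), zero_lt_one, fun x hx => hDU ?_⟩
    rw [Finset.sup_singleton, Seminorm.mem_ball_zero] at hx
    exact hx.le

open scoped ComplexOrder in
theorem psStep_le {t : TopologicalSpace E} (h : IsLC t) : psStep t ≤ t := by
  obtain ⟨h1, h2, h3⟩ := h
  have h2' : ContinuousSMul ℝ E := IsScalarTower.continuousSMul ℂ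
  have h3' : LocallyConvexSpace ℂ E :=
    LocallyConvexSpace.ofBases ℂ E (fun _ => id) (fun x s => s ∈ 𝓝 x ∧ Convex ℝ s)
      (LocallyConvexSpace.convex_basis (𝕜 := ℝ)) fun x s hs =>
        convex_RCLike_iff_convex_real.2 hs.2
  have : PolynormableSpace ℂ E := inferInstance
  have hw := PolynormableSpace.withSeminorms ℂ E
  have hcap : ∀ p : Seminorm ℂ E, Continuous p →
      IsClosed {x | p x ≤ 1} ∧ IsCapacious {x | p x ≤ 1} := by
    intro p hp
    refine ⟨isClosed_le hp continuous_const, fun S hS => ?_⟩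
    obtain ⟨F, hF, hSF⟩ := hS {x | p x ≤ 1} (by
      filter_upwards [hp.continuousAt.eventually_lt continuousAt_const
        (show p 0 < 1 by simp)] with x hx using hx.le)
    exact ⟨F, hF, by rwa [add_comm]⟩
  have hid : Continuous[psStep t, t] (LinearMap.id : E →ₗ[ℂ] E) := by
    refine WithSeminorms.continuous_of_isBounded (withSeminorms_psStep t) hw _ fun p => ?_
    refine ⟨{⟨p.1, hcap p.1 p.2⟩}, 1, ?_⟩
    rw [Finset.sup_singleton, one_smul]
    exact le_rfl
  exact continuous_id_iff_le.1 hid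

theorem projSeries_antitone {t : TopologicalSpace E} (h : IsLC t) : Antitone (projSeries t) := by
  intro μ ν
  induction ν using Ordinal.limitRecOn with
  | zero => intro hμ; rw [le_antisymm hμ (zero_le)]
  | add_one ν ih =>
    intro hμ
    rcases hμ.eq_or_lt with rfl | hμ
    · exact le_rfl
    · rw [projSeries_add_one]
      exact (psStep_le (h.projSeries ν)).trans (ih (Order.lt_add_one_iff.1 hμ))
  | limit ν hν ih =>
    intro hμ
    rcases hμ.eq_or_lt with rfl | hμ
    · exact le_rfl
    · rw [projSeries_limit t ν hν]
      exact iInf_le (fun κ : Set.Iio ν => projSeries t κ) ⟨μ, hμ⟩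

/-- The projective series stabilizes. -/
theorem exists_projSeries_eq {t : TopologicalSpace E} (h : IsLC t) :
    ∃ μ : Ordinal.{u}, ∀ ν, μ ≤ ν → projSeries t ν = projSeries t μ := by
  have hni := not_injective_of_ordinal (projSeries t)
  rw [Function.Injective] at hni
  push Not at hni
  obtain ⟨a, b, hab, hne⟩ := hni
  wlog hlt : a < b generalizing a b
  · exact this b a hab.symm hne.symm (lt_of_le_of_ne (not_lt.1 hlt) hne.symm)
  have hstep : psStep (projSeries t a) = projSeries t a := by
    rw [← projSeries_add_one]
    refine le_antisymm (projSeries_antitone h (by simp)) ?_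
    conv_lhs => rw [hab]
    exact projSeries_antitone h (Order.add_one_le_iff.2 hlt)
  refine ⟨a, fun ν => ?_⟩
  induction ν using Ordinal.limitRecOn with
  | zero => intro hν; rw [le_antisymm hν (zero_le)]
  | add_one ν ih =>
    intro hν
    rcases hν.eq_or_lt with rfl | hν
    · rfl
    · rw [projSeries_add_one, ih (Order.lt_add_one_iff.1 hν), hstep]
  | limit ν hν ih =>
    intro haν
    refine le_antisymm (projSeries_antitone h haν) ?_
    rw [projSeries_limit t ν hν]
    refine le_iInf fun κ => ?_
    rcases le_total a κ with hκ | hκ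
    · exact (ih κ κ.2 hκ).ge
    · exact projSeries_antitone h hκ

theorem exists_projSeries_eq_psTopology {t : TopologicalSpace E} (h : IsLC t) :
    ∃ μ : Ordinal.{u}, ∀ ν, μ ≤ ν → projSeries t ν = psTopology t := by
  obtain ⟨μ, hμ⟩ := exists_projSeries_eq h
  have h1 : projSeries t μ = psTopology t := by
    refine le_antisymm (le_iInf fun ν => ?_) (iInf_le _ μ)
    rcases le_total μ ν with hν | hν
    · exact (hμ ν hν).ge
    · exact projSeries_antitone h hν
  exact ⟨μ, fun ν hν => (hμ ν hν).trans h1⟩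

theorem psStep_psTopology {t : TopologicalSpace E} (h : IsLC t) :
    psStep (psTopology t) = psTopology t := by
  obtain ⟨μ, hμ⟩ := exists_projSeries_eq_psTopology h
  have := projSeries_add_one t μ
  rwa [hμ μ le_rfl, hμ (μ + 1) (by simp), eq_comm] at this

/-- The pseudosaturation is pseudosaturated. -/
theorem PsSat.isPseudosaturated [t : TopologicalSpace E] [h1 : IsTopologicalAddGroup E]
    [h2 : ContinuousSMul ℂ E] [h3 : LocallyConvexSpace ℝ E] : IsPseudosaturated (PsSat E) := by
  intro D hD0 hD1 hD2 hD3
  have hb := hasBasis_nhds_zero_psStep (E := PsSat E)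
  have he : psStep (E := PsSat E) (PsSat.instTopologicalSpace E) = PsSat.instTopologicalSpace E :=
    psStep_psTopology (E := E) ⟨h1, h2, h3⟩
  rw [he] at hb
  exact hb.mem_of_mem ⟨hD0, hD1, hD2, hD3⟩

end StepLemmas

/-! ### Pseudosaturation of operators -/

section PsSatMap

variable {E : Type u} {F : Type v} [AddCommGroup E] [Module ℂ E] [AddCommGroup F] [Module ℂ F]

theorem continuous_psStep {t : TopologicalSpace E} (ht : IsLC t) {s : TopologicalSpace F}
    (φ : E →ₗ[ℂ] F) (h : Continuous[t, s] φ) : Continuous[psStep t, psStep s] φ := by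
  have := ht.1
  have := ht.2.1
  refine WithSeminorms.continuous_of_isBounded (withSeminorms_psStep t) (withSeminorms_psStep s) _
    fun p => ?_
  classical
  have hcl : IsClosed[t] {x | (p.1.comp φ) x ≤ 1} := p.2.1.preimage h
  have hcap : @IsCapacious E _ t {x | (p.1.comp φ) x ≤ 1} := by
    refine capacious_of_exists_finite fun S hS => ?_
    obtain ⟨A, hA, hSA⟩ := p.2.2 _ ((hS.smul 2).image φ.toAddMonoidHom h)
    let c : F → E := fun a => if h : ∃ x, p.1 (φ ((2 : ℂ) • x) - a) ≤ 1 then h.choose else 0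
    refine ⟨c '' A, hA.image c, fun x hx => ?_⟩
    obtain ⟨d, hd, a, ha, hda⟩ := hSA ⟨(2 : ℂ) • x, ⟨x, hx, rfl⟩, rfl⟩
    have hx1 : p.1 (φ ((2 : ℂ) • x) - a) ≤ 1 := by
      have : φ ((2 : ℂ) • x) = d + a := hda.symm
      rw [this, add_sub_cancel_right]
      exact hd
    have hex : ∃ x, p.1 (φ ((2 : ℂ) • x) - a) ≤ 1 := ⟨x, hx1⟩
    have hc : c a = hex.choose := dif_pos hex
    have hc1 : p.1 (φ ((2 : ℂ) • c a) - a) ≤ 1 := by rw [hc]; exact hex.choose_spec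
    refine ⟨c a, ⟨a, ha, rfl⟩, ?_⟩
    have h2 := map_sub_le_add p.1 (φ ((2 : ℂ) • x) - a) (φ ((2 : ℂ) • c a) - a)
    rw [sub_sub_sub_cancel_right, ← map_sub, ← smul_sub, map_smul, map_smul_eq_mul] at h2
    have h3 : (p.1.comp φ) (x - c a) = p.1 (φ (x - c a)) := rfl
    have h4 : ‖(2 : ℂ)‖ = 2 := by simp
    rw [h4] at h2
    rw [h3]
    linarith
  refine ⟨{⟨p.1.comp φ, hcl, hcap⟩}, 1, ?_⟩
  rw [Finset.sup_singleton, one_smul]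
  exact le_rfl

theorem continuous_psTopology {t : TopologicalSpace E} (ht : IsLC t) {s : TopologicalSpace F}
    (φ : E →ₗ[ℂ] F) (h : Continuous[t, s] φ) : Continuous[psTopology t, psTopology s] φ := by
  refine continuous_iInf_rng.2 ?_
  intro μ
  induction μ using Ordinal.limitRecOn with
  | zero => rw [projSeries_zero]; exact continuous_le_dom (psTopology_le t) h
  | add_one μ ih =>
    rw [projSeries_add_one, ← psStep_psTopology ht]
    exact continuous_psStep ht.psTopology φ ih
  | limit μ hμ ih =>
    rw [projSeries_limit s μ hμ, continuous_iInf_rng]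
    exact fun κ => ih κ.1 κ.2

/-- The pseudosaturation `φ^△ : E^△ → F^△` of an operator `φ : E → F` (the same map of sets;
the unique operator with `toBase F ∘ φ^△ = φ ∘ toBase E`). -/
def PsSat.map [t : TopologicalSpace E] [h1 : IsTopologicalAddGroup E] [h2 : ContinuousSMul ℂ E]
    [h3 : LocallyConvexSpace ℝ E] [s : TopologicalSpace F] (φ : E →L[ℂ] F) :
    PsSat E →L[ℂ] PsSat F where
  toLinearMap := (φ : E →ₗ[ℂ] F)
  cont := continuous_psTopology (t := t) ⟨h1, h2, h3⟩ (s := s) (φ : E →ₗ[ℂ] F) φ.continuous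

theorem PsSat.toBase_map [TopologicalSpace E] [IsTopologicalAddGroup E] [ContinuousSMul ℂ E]
    [LocallyConvexSpace ℝ E] [TopologicalSpace F] (φ : E →L[ℂ] F) (x : PsSat E) :
    PsSat.toBase F (PsSat.map φ x) = φ (PsSat.toBase E x) := rfl

end PsSatMap

/-! ### Pseudocompletion, through the injective series -/

section InjSeries

variable {E : Type u} [AddCommGroup E] [Module ℂ E] [TopologicalSpace E]
  [IsTopologicalAddGroup E] [ContinuousConstSMul ℂ E]

/-- The step of the injective series, for a subspace `M` of a complete space `E`: the subspace of
all limits in `E` of totally bounded nets of elements of `M`, i.e. of all points adherent to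
a totally bounded subset of `M`. -/
def injStep (M : Submodule ℂ E) : Submodule ℂ E where
  carrier := {x | ∃ S : Set E, S ⊆ M ∧ IsTotBdd S ∧ x ∈ closure S}
  add_mem' := by
    rintro x y ⟨S, hSM, hS, hx⟩ ⟨T, hTM, hT, hy⟩
    refine ⟨S + T, ?_, hS.add hT, ?_⟩
    · rintro _ ⟨a, ha, b, hb, rfl⟩
      exact M.add_mem (hSM ha) (hTM hb)
    · exact map_mem_closure₂ continuous_add hx hy fun a ha b hb => Set.add_mem_add ha hb
  zero_mem' := ⟨{0}, by simp, isTotBdd_singleton 0, subset_closure rfl⟩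
  smul_mem' := by
    rintro c x ⟨S, hSM, hS, hx⟩
    refine ⟨c • S, ?_, hS.smul c, ?_⟩
    · rintro _ ⟨a, ha, rfl⟩
      exact M.smul_mem c (hSM ha)
    · exact map_mem_closure (continuous_const_smul c) hx fun a ha => ⟨a, ha, rfl⟩

theorem le_injStep (M : Submodule ℂ E) : M ≤ injStep M := fun x hx =>
  ⟨{x}, by simpa using hx, isTotBdd_singleton x, subset_closure rfl⟩

/-- The injective series `M^λ` of a subspace `M` of a complete space `E`: `M^0 = M`, `M^{λ+1}` is
obtained from `M^λ` by the step above, and at a limit ordinal one takes the union of the previous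
subspaces (which increase, so that the union is the supremum). -/
noncomputable def injSeries (M : Submodule ℂ E) (l : Ordinal.{u}) : Submodule ℂ E :=
  Ordinal.limitRecOn l M (fun _ N => injStep N) (fun o _ N => ⨆ κ : Set.Iio o, N κ.1 κ.2)

theorem injSeries_zero (M : Submodule ℂ E) : injSeries M 0 = M :=
  Ordinal.limitRecOn_zero ..

theorem injSeries_add_one (M : Submodule ℂ E) (l : Ordinal.{u}) :
    injSeries M (l + 1) = injStep (injSeries M l) :=
  Ordinal.limitRecOn_add_one ..

theorem injSeries_limit (M : Submodule ℂ E) (l : Ordinal.{u}) (h : Order.IsSuccLimit l) :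
    injSeries M l = ⨆ κ : Set.Iio l, injSeries M κ :=
  Ordinal.limitRecOn_limit (motive := fun _ => Submodule ℂ E) (h := h) ..

theorem injSeries_monotone (M : Submodule ℂ E) : Monotone (injSeries M) := by
  intro μ ν
  induction ν using Ordinal.limitRecOn with
  | zero => intro hμ; rw [le_antisymm hμ (zero_le)]
  | add_one ν ih =>
    intro hμ
    rcases hμ.eq_or_lt with rfl | hμ
    · exact le_rfl
    · rw [injSeries_add_one]
      exact (ih (Order.lt_add_one_iff.1 hμ)).trans (le_injStep _)
  | limit ν hν ih =>
    intro hμ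
    rcases hμ.eq_or_lt with rfl | hμ
    · exact le_rfl
    · rw [injSeries_limit M ν hν]
      exact le_iSup (fun κ : Set.Iio ν => injSeries M κ) ⟨μ, hμ⟩

/-- The common value of `M^λ` for all sufficiently large `λ` (the series increases, so this is
its supremum). -/
noncomputable def injLimit (M : Submodule ℂ E) : Submodule ℂ E :=
  ⨆ l : Ordinal.{u}, injSeries M l

theorem le_injLimit (M : Submodule ℂ E) : M ≤ injLimit M :=
  (injSeries_zero M).ge.trans (le_iSup (injSeries M) 0)

end InjSeries

section Completion

open UniformSpace

attribute [local instance] IsTopologicalAddGroup.rightUniformSpace isUniformAddGroup_of_addCommGroup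
  uniformContinuousConstSMul_of_continuousConstSMul

variable (X : Type u) [AddCommGroup X] [Module ℂ X] [TopologicalSpace X]
  [IsTopologicalAddGroup X] [ContinuousSMul ℂ X]

/-- The completion of a locally convex space (with respect to its additive uniform structure). -/
def LCCompletion : Type u := Completion X

noncomputable instance : AddCommGroup (LCCompletion X) := inferInstanceAs (AddCommGroup (Completion X))

noncomputable instance : Module ℂ (LCCompletion X) := inferInstanceAs (Module ℂ (Completion X))

noncomputable instance : TopologicalSpace (LCCompletion X) :=
  inferInstanceAs (TopologicalSpace (Completion X))

instance : IsTopologicalAddGroup (LCCompletion X) := inferInstanceAs (IsTopologicalAddGroup (Completion X))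

instance : ContinuousSMul ℂ (LCCompletion X) := by
  change ContinuousSMul ℂ (Completion X)
  let e : ℂ →+ ℂ := AddMonoidHom.id ℂ
  have de : IsDenseInducing e := ⟨.id, denseRange_id⟩
  have df : IsDenseInducing (Completion.toCompl : X →+ Completion X) :=
    Completion.isDenseInducing_coe
  let m : ℂ →+ X →+ Completion X := (smulAddHom ℂ X).compr₂ Completion.toCompl
  have hm : Continuous fun p : ℂ × X => m p.1 p.2 :=
    (Completion.continuous_coe X).comp continuous_smul
  have hext := de.extend_Z_bilin df hm
  refine ⟨hext.congr ?_⟩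
  rintro ⟨c, x⟩
  induction x using Completion.induction_on with
  | hp => exact isClosed_eq (hext.comp (by fun_prop)) (continuous_const_smul c)
  | ih x =>
    have := (de.prodMap df).extend_eq hm (c, x)
    exact this.trans (Completion.coe_smul c x)

/-- The natural map from `X` to its completion. -/
noncomputable def LCCompletion.coe : X →L[ℂ] LCCompletion X where
  toFun x := (x : Completion X)
  map_add' := Completion.coe_add
  map_smul' c x := Completion.coe_smul c x
  cont := Completion.continuous_coe X

/-- The pseudocompletion of a locally convex space `X`: the subspace of the completion of `X` at
which the injective series of `X` stabilizes, with the topology induced from the completion. -/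
def PsCompl : Type u := injLimit (LinearMap.range (LCCompletion.coe X : X →ₗ[ℂ] LCCompletion X))

namespace PsCompl

noncomputable instance : AddCommGroup (PsCompl X) :=
  inferInstanceAs (AddCommGroup (injLimit (LinearMap.range (LCCompletion.coe X : X →ₗ[ℂ] LCCompletion X))))

noncomputable instance : Module ℂ (PsCompl X) :=
  inferInstanceAs (Module ℂ (injLimit (LinearMap.range (LCCompletion.coe X : X →ₗ[ℂ] LCCompletion X))))

noncomputable instance : TopologicalSpace (PsCompl X) :=
  inferInstanceAs (TopologicalSpace (injLimit (LinearMap.range (LCCompletion.coe X : X →ₗ[ℂ] LCCompletion X))))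

instance : IsTopologicalAddGroup (PsCompl X) :=
  inferInstanceAs
    (IsTopologicalAddGroup (injLimit (LinearMap.range (LCCompletion.coe X : X →ₗ[ℂ] LCCompletion X))))

instance : ContinuousSMul ℂ (PsCompl X) :=
  inferInstanceAs
    (ContinuousSMul ℂ (injLimit (LinearMap.range (LCCompletion.coe X : X →ₗ[ℂ] LCCompletion X))))

/-- The natural map from `X` to its pseudocompletion. -/
noncomputable def ofBase : X →L[ℂ] PsCompl X :=
  (LCCompletion.coe X).codRestrict _ fun x => le_injLimit _ ⟨x, rfl⟩

end PsCompl

end Completion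

/-! ### The space of operators, the tensor fraction, stereotype spaces -/

section PrimFrac

variable (F : Type v) (E : Type u) [AddCommGroup F] [Module ℂ F] [TopologicalSpace F]
  [IsTopologicalAddGroup F] [ContinuousSMul ℂ F]
  [AddCommGroup E] [Module ℂ E] [TopologicalSpace E]

/-- The primary tensor fraction `F : E`: the space of operators (continuous linear maps) `E → F`
with the topology of uniform convergence on totally bounded sets. -/
abbrev PrimFrac : Type (max u v) :=
  UniformConvergenceCLM (RingHom.id ℂ) F {S : Set E | IsTotBdd S}

instance [IsTopologicalAddGroup E] [ContinuousSMul ℂ E] : ContinuousSMul ℂ (PrimFrac F E) := by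
  refine UniformConvergenceCLM.continuousSMul _ _ _ fun S hS => ?_
  let : UniformSpace E := IsTopologicalAddGroup.rightUniformSpace E
  have : IsUniformAddGroup E := isUniformAddGroup_of_addCommGroup
  exact ((isTotBdd_iff_totallyBounded S).1 hS).isVonNBounded ℂ

instance [LocallyConvexSpace ℝ F] : LocallyConvexSpace ℝ (PrimFrac F E) := by
  have : ContinuousSMul ℝ F := IsScalarTower.continuousSMul ℂ
  refine UniformConvergenceCLM.locallyConvexSpace ℝ _ ⟨∅, fun U _ => ⟨∅, by simp⟩⟩
    (directedOn_of_sup_mem fun S T hS hT => ?_)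
  intro U hU
  obtain ⟨A, hA, hSA⟩ := hS U hU
  obtain ⟨B, hB, hTB⟩ := hT U hU
  exact ⟨A ∪ B, hA.union hB, Set.union_subset
    (hSA.trans (Set.add_subset_add_right Set.subset_union_left))
    (hTB.trans (Set.add_subset_add_right Set.subset_union_right))⟩

/-- The stereotype tensor fraction `F ⊘ E = (F : E)^△`. -/
abbrev SteFrac : Type (max u v) := PsSat (PrimFrac F E)

/-- The dual space `E^⋆` of continuous functionals with the topology of uniform convergence on
totally bounded sets. -/
abbrev StarDual : Type u := PrimFrac ℂ E

/-- A locally convex space `E` is stereotype if the natural map `x ↦ (f ↦ f x)` is an isomorphism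
of locally convex spaces between `E` and `(E^⋆)^⋆`. -/
def IsStereotype : Prop :=
  ∃ e : E ≃L[ℂ] StarDual (StarDual E), ∀ (x : E) (f : StarDual E), e x f = f x

end PrimFrac

section PrimFracMap

variable {F : Type v} {F' : Type v'} {E : Type u} {E' : Type u'}
  [AddCommGroup F] [Module ℂ F] [TopologicalSpace F] [IsTopologicalAddGroup F] [ContinuousSMul ℂ F]
  [AddCommGroup F'] [Module ℂ F'] [TopologicalSpace F'] [IsTopologicalAddGroup F']
  [ContinuousSMul ℂ F']
  [AddCommGroup E] [Module ℂ E] [TopologicalSpace E]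
  [AddCommGroup E'] [Module ℂ E'] [TopologicalSpace E']

/-- The operator `(β : α) : (F : E) → (F' : E')`, `ψ ↦ β ∘ ψ ∘ α`, for operators `β : F → F'`
and `α : E' → E`. -/
noncomputable def PrimFrac.map (β : F →L[ℂ] F') (α : E' →L[ℂ] E) : PrimFrac F E →L[ℂ] PrimFrac F' E' :=
  (α.precompUniformConvergenceCLM F' {S | IsTotBdd S} {S | IsTotBdd S}
      fun _ hS => hS.image (α : E' →+ E) α.continuous).comp
    (β.postcompUniformConvergenceCLM {S | IsTotBdd S})

theorem PrimFrac.map_apply (β : F →L[ℂ] F') (α : E' →L[ℂ] E) (ψ : PrimFrac F E) (x : E') :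
    PrimFrac.map β α ψ x = β (ψ (α x)) := rfl

end PrimFracMap

end Ster

open Ster

set_option linter.unusedSectionVars false

namespace Ster

universe u v

open Filter

/-! ### Totally bounded sets and finite nets with centres inside the set. -/

section TotallyBounded

variable {E : Type u} [AddCommGroup E] [TopologicalSpace E]

/-! A Hausdorff locally convex space that is both pseudosaturated and pseudocomplete is stereotype
(`IsPseudosaturated.isStereotype`). Pseudosaturation makes totally bounded sets of functionals
equicontinuous, so the bidual map is continuous; polars of neighbourhoods are totally bounded, so by
the bipolar theorem it is open onto its image; pseudocompleteness makes closed totally bounded sets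
compact, so by a Mackey–Arens argument it is onto. All four spaces have both properties:
pseudosaturation preserves pseudocompleteness, pseudocompletion preserves pseudosaturatedness, and
operators from a pseudosaturated to a pseudocomplete space form a pseudocomplete space.

For the isomorphism, an operator `X → Y` is lifted to `PsSat Y` by functoriality, since `X` is its
own pseudosaturation, and then extended to `PsCompl X`, since `PsSat Y` is pseudocomplete. This
gives the algebraic inverse `G`.

The main point is that `G` is continuous on the pseudosaturation of `Y : X`. That space being
pseudosaturated, it suffices that `{f | G f (S) ⊆ U}` is closed, convex, balanced and capacious. On
totally bounded sets pseudosaturation does not change the topology, so a totally bounded set of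
operators to `Y` stays totally bounded, hence equicontinuous, as operators to `PsSat Y`; its
extensions are equicontinuous by density, and Ascoli's argument yields capacity. Closedness and
pointwise total boundedness need continuity of `f ↦ G f x`, which is propagated along the injective
series (`continuous_extension_eval`). -/

theorem IsTotBdd.mono {S T : Set E} (hT : IsTotBdd T) (h : S ⊆ T) : IsTotBdd S := fun U hU =>
  let ⟨F, hF, hTF⟩ := hT U hU
  ⟨F, hF, h.trans hTF⟩

/-- If a map takes finitely many values on a set, these are taken on a finite subset. -/
theorem exists_finite_subset_image_eq {α β : Type*} {A : Set α} {c : α → β}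
    (h : (c '' A).Finite) : ∃ A' ⊆ A, A'.Finite ∧ ∀ a ∈ A, ∃ a' ∈ A', c a = c a' := by
  obtain ⟨A', hA', hb⟩ := Set.exists_subset_bijOn A c
  refine ⟨A', hA', hb.finite_iff_finite.2 h, fun a ha => ?_⟩
  obtain ⟨a', ha', h'⟩ := hb.surjOn ⟨a, ha, rfl⟩
  exact ⟨a', ha', h'.symm⟩

theorem exists_nhds_zero_sub [IsTopologicalAddGroup E] {U : Set E} (hU : U ∈ 𝓝 0) :
    ∃ V ∈ 𝓝 (0 : E), ∀ x ∈ V, ∀ y ∈ V, x - y ∈ U := by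
  have : Tendsto (fun p : E × E => p.1 - p.2) (𝓝 (0, 0)) (𝓝 0) := by
    have h : Continuous fun p : E × E => p.1 - p.2 := by fun_prop
    simpa using h.tendsto (0, 0)
  rw [nhds_prod_eq] at this
  obtain ⟨V, hV, hVU⟩ := mem_prod_self_iff.1 (this hU)
  exact ⟨V, hV, fun x hx y hy => hVU (Set.mk_mem_prod hx hy)⟩

theorem isTotBdd_of_exists {S : Set E}
    (h : ∀ U ∈ 𝓝 (0 : E), ∃ F : Set E, F.Finite ∧ ∀ x ∈ S, ∃ y ∈ F, x - y ∈ U) : IsTotBdd S := by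
  intro U hU
  obtain ⟨F, hF, hSF⟩ := h U hU
  refine ⟨F, hF, fun x hx => ?_⟩
  obtain ⟨y, hy, hxy⟩ := hSF x hx
  exact ⟨y, hy, x - y, hxy, by simp⟩

/-- Finitely many maps with totally bounded images are simultaneously approximated on a set by
their values on a finite subset. -/
theorem exists_finite_forall_sub_mem [IsTopologicalAddGroup E] {α ι : Type*} {I : Set ι}
    (hI : I.Finite) (e : ι → α → E) {A : Set α} (hA : ∀ i ∈ I, IsTotBdd (e i '' A))
    {U : Set E} (hU : U ∈ 𝓝 0) :
    ∃ A' ⊆ A, A'.Finite ∧ ∀ a ∈ A, ∃ a' ∈ A', ∀ i ∈ I, e i a - e i a' ∈ U := by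
  obtain ⟨V, hV, hVU⟩ := exists_nhds_zero_sub hU
  choose! F hF hAF using fun i hi => hA i hi V hV
  have : ∀ i ∈ I, ∀ a ∈ A, ∃ y ∈ F i, e i a - y ∈ V := by
    intro i hi a ha
    obtain ⟨y, hy, z, hz, hyz⟩ := hAF i hi ⟨a, ha, rfl⟩
    refine ⟨y, hy, ?_⟩
    rw [← hyz]
    simpa using hz
  choose! y hyF hyV using this
  have := hI.to_subtype
  -- Each `a` is coded by its tuple of nearby centres; only finitely many tuples occur, and one
  -- representative of each suffices.
  obtain ⟨A', hA', hfin, h⟩ := exists_finite_subset_image_eq (A := A)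
    (c := fun a (i : I) => y i a) ((Set.Finite.pi' fun i : I => hF i i.2).subset (by
      rintro _ ⟨a, ha, rfl⟩ i
      exact hyF i i.2 a ha))
  refine ⟨A', hA', hfin, fun a ha => ?_⟩
  obtain ⟨a', ha', haa'⟩ := h a ha
  refine ⟨a', ha', fun i hi => ?_⟩
  have h1 : y i a = y i a' := congr_fun haa' ⟨i, hi⟩
  have := hVU _ (hyV i hi a ha) _ (hyV i hi a' (hA' ha'))
  rwa [h1, sub_sub_sub_cancel_right] at this

theorem IsTotBdd.exists_finite_subset [IsTopologicalAddGroup E] {S : Set E} (hS : IsTotBdd S)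
    {U : Set E} (hU : U ∈ 𝓝 0) : ∃ F ⊆ S, F.Finite ∧ ∀ x ∈ S, ∃ y ∈ F, x - y ∈ U := by
  obtain ⟨F, hFS, hF, h⟩ := exists_finite_forall_sub_mem (Set.finite_singleton ())
    (fun _ x => x) (A := S) (by simpa using hS) hU
  refine ⟨F, hFS, hF, fun x hx => ?_⟩
  obtain ⟨y, hy, hxy⟩ := h x hx
  exact ⟨y, hy, hxy () rfl⟩

theorem IsTotBdd.neg [IsTopologicalAddGroup E] {S : Set E} (hS : IsTotBdd S) : IsTotBdd (-S) := by
  have := hS.image (-AddMonoidHom.id E) continuous_neg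
  rwa [show (⇑(-AddMonoidHom.id E) '' S) = -S from Set.image_neg_eq_neg] at this

theorem IsTotBdd.sub [IsTopologicalAddGroup E] {S T : Set E} (hS : IsTotBdd S)
    (hT : IsTotBdd T) : IsTotBdd (S - T) := by
  rw [sub_eq_add_neg]
  exact hS.add hT.neg

theorem IsTotBdd.union {S T : Set E} (hS : IsTotBdd S) (hT : IsTotBdd T) : IsTotBdd (S ∪ T) :=
  fun U hU =>
    let ⟨A, hA, hSA⟩ := hS U hU
    let ⟨B, hB, hTB⟩ := hT U hU
    ⟨A ∪ B, hA.union hB, Set.union_subset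
      (hSA.trans (Set.add_subset_add_right Set.subset_union_left))
      (hTB.trans (Set.add_subset_add_right Set.subset_union_right))⟩

/-- The centres of a net for the image can be taken in the image itself, so they lift; injectivity
of `f` plays no role. -/
theorem IsTotBdd.preimage [IsTopologicalAddGroup E] {F : Type v} [AddCommGroup F]
    [TopologicalSpace F] [IsTopologicalAddGroup F] {S : Set F} (hS : IsTotBdd S) {f : E →+ F}
    (hf : IsInducing f) : IsTotBdd (f ⁻¹' S) := by
  refine isTotBdd_of_exists fun U hU => ?_
  rw [hf.nhds_eq_comap, map_zero] at hU
  obtain ⟨V, hV, hVU⟩ := hU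
  obtain ⟨A, hA, hfin, h⟩ := exists_finite_forall_sub_mem (Set.finite_singleton ())
    (fun _ x => f x) (A := f ⁻¹' S) (fun _ _ => hS.mono (Set.image_preimage_subset f S)) hV
  refine ⟨A, hfin, fun x hx => ?_⟩
  obtain ⟨y, hy, hxy⟩ := h x hx
  exact ⟨y, hy, hVU (by simpa using hxy () rfl)⟩

/-- Eliminates the uniform structure, so that several group topologies on one set can be compared.
-/
theorem isPseudocomplete_iff [IsTopologicalAddGroup E] : IsPseudocomplete E ↔
    ∀ f : Filter E, f.NeBot → (∀ U ∈ 𝓝 (0 : E), ∃ A ∈ f, ∀ x ∈ A, ∀ y ∈ A, x - y ∈ U) →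
      (∃ S ∈ f, IsTotBdd S) → ∃ x, f ≤ 𝓝 x := by
  let := IsTopologicalAddGroup.rightUniformSpace E
  have : IsUniformAddGroup E := isUniformAddGroup_of_addCommGroup
  have key : ∀ f : Filter E, Cauchy f ↔
      (f.NeBot ∧ ∀ U ∈ 𝓝 (0 : E), ∃ A ∈ f, ∀ x ∈ A, ∀ y ∈ A, x - y ∈ U) := by
    intro f
    rw [IsUniformAddGroup.cauchy_iff_tendsto_swapped]
    refine and_congr_right fun _ => ⟨fun h U hU => ?_, fun h U hU => ?_⟩
    · obtain ⟨A, hA, hAU⟩ := mem_prod_self_iff.1 (h hU)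
      exact ⟨A, hA, fun x hx y hy => hAU (Set.mk_mem_prod hy hx)⟩
    · obtain ⟨A, hA, hAU⟩ := h U hU
      exact mem_prod_self_iff.2 ⟨A, hA, fun p hp => hAU _ hp.2 _ hp.1⟩
  constructor
  · intro h f h1 h2 h3
    exact h f ((key f).2 ⟨h1, h2⟩) h3
  · intro h f h1 h3
    exact h f ((key f).1 h1).1 ((key f).1 h1).2 h3

/-- In a pseudocomplete space embedded in `F`, totally bounded subsets have the same closure
in both spaces. -/
theorem IsPseudocomplete.mem_range_of_mem_closure [IsTopologicalAddGroup E]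
    (hE : IsPseudocomplete E) {F : Type v} [AddCommGroup F]
    [TopologicalSpace F] [IsTopologicalAddGroup F] [T2Space F] {f : E →+ F} (hf : IsInducing f)
    {S : Set F} (hS : IsTotBdd S) (hSf : S ⊆ Set.range f) {y : F} (hy : y ∈ closure S) :
    y ∈ Set.range f := by
  have hne : (𝓝 y ⊓ 𝓟 S).NeBot := mem_closure_iff_clusterPt.1 hy
  have hcne : (comap f (𝓝 y ⊓ 𝓟 S)).NeBot :=
    hne.comap_of_range_mem (mem_inf_of_right (mem_principal.2 hSf))
  -- The trace on `S` of the neighbourhood filter of `y`, pulled back to `E`, is Cauchy and contains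
  -- the totally bounded set `f ⁻¹' S`; its limit must map to `y`.
  obtain ⟨x, hx⟩ := isPseudocomplete_iff.1 hE (comap f (𝓝 y ⊓ 𝓟 S)) hcne (fun U hU => by
      rw [hf.nhds_eq_comap, map_zero] at hU
      obtain ⟨V, hV, hVU⟩ := hU
      obtain ⟨W, hW, hWV⟩ := exists_nhds_zero_sub hV
      have hW' : (fun z => z - y) ⁻¹' W ∈ 𝓝 y :=
        (continuous_id.sub continuous_const).continuousAt.preimage_mem_nhds (by simpa using hW)
      refine ⟨f ⁻¹' ((fun z => z - y) ⁻¹' W), preimage_mem_comap (mem_inf_of_left hW'), ?_⟩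
      intro a ha b hb
      refine hVU ?_
      have := hWV _ ha _ hb
      simpa using this)
    ⟨f ⁻¹' S, preimage_mem_comap (mem_inf_of_right (mem_principal_self S)), hS.preimage hf⟩
  refine ⟨x, tendsto_nhds_unique (f := f) (l := comap f (𝓝 y ⊓ 𝓟 S)) ?_ ?_⟩
  · exact (hf.continuous.tendsto x).mono_left hx
  · exact tendsto_comap.mono_right inf_le_left

theorem isCapacious_of_exists {D : Set E} (h : ∀ S : Set E, IsTotBdd S →
    ∃ F : Set E, F.Finite ∧ ∀ x ∈ S, ∃ y ∈ F, x - y ∈ D) : IsCapacious D := by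
  intro S hS
  obtain ⟨F, hF, hSF⟩ := h S hS
  refine ⟨F, hF, fun x hx => ?_⟩
  obtain ⟨y, hy, hxy⟩ := hSF x hx
  exact ⟨x - y, hxy, y, hy, sub_add_cancel x y⟩

end TotallyBounded

/-! ### Closed convex balanced sets, capacious or neighbourhoods of zero. -/

section LocallyConvex

theorem half_sub_mem {E : Type u} [AddCommGroup E] [Module ℂ E] {D : Set E} (h1 : Convex ℝ D)
    (h2 : Balanced ℂ D) {x y : E} (hx : x ∈ D)
    (hy : y ∈ D) : (2 : ℂ)⁻¹ • (x - y) ∈ D := by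
  have := h1 hx (h2.neg_mem_iff.2 hy) (a := 1 / 2) (b := 1 / 2) (by norm_num) (by norm_num)
    (by norm_num)
  rw [← smul_add, ← sub_eq_add_neg] at this
  convert this using 1
  rw [← Complex.coe_smul]
  norm_num

variable {E : Type u} [AddCommGroup E] [Module ℂ E] [TopologicalSpace E]

open scoped ComplexOrder in
theorem hasBasis_nhds_zero_closed_convex_balanced [IsTopologicalAddGroup E] [ContinuousSMul ℂ E]
    [LocallyConvexSpace ℝ E] : (𝓝 (0 : E)).HasBasis
      (fun U => U ∈ 𝓝 (0 : E) ∧ IsClosed U ∧ Convex ℝ U ∧ Balanced ℂ U) id := by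
  have : LocallyConvexSpace ℂ E :=
    LocallyConvexSpace.ofBases ℂ E (fun _ => id) (fun x s => s ∈ 𝓝 x ∧ Convex ℝ s)
      (LocallyConvexSpace.convex_basis (𝕜 := ℝ)) fun x s hs =>
        convex_RCLike_iff_convex_real.2 hs.2
  refine (nhds_hasBasis_absConvex_closed ℂ E).congr (fun s => ?_) fun _ _ => rfl
  rw [AbsConvex, convex_RCLike_iff_convex_real, and_comm (a := Balanced ℂ s)]

/-- Every neighbourhood of zero is a triple sum of a closed convex balanced one. -/
theorem exists_nhds_zero_add_add_sub [IsTopologicalAddGroup E] [ContinuousSMul ℂ E]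
    [LocallyConvexSpace ℝ E] {U : Set E} (hU : U ∈ 𝓝 0) :
    ∃ V ∈ 𝓝 (0 : E), (IsClosed V ∧ Convex ℝ V ∧ Balanced ℂ V) ∧
      ∀ x ∈ V, ∀ y ∈ V, ∀ z ∈ V, x + y - z ∈ U := by
  obtain ⟨V, hV, hVU⟩ := exists_nhds_zero_sub hU
  obtain ⟨W, hW, hWV⟩ := exists_nhds_zero_half hV
  obtain ⟨D, hD, hDW⟩ := hasBasis_nhds_zero_closed_convex_balanced.mem_iff.1
    (inter_mem hV hW)
  exact ⟨D, hD.1, hD.2, fun x hx y hy z hz =>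
    hVU _ (hWV _ (hDW hx).2 _ (hDW hy).2) _ (hDW hz).1⟩

/-- A capacious set cannot be shrunk like a neighbourhood in order to move the centres into `S`.
Instead `2 • S` is covered, and the difference of two points sharing a centre is halved, which
returns to `D` itself. -/
theorem IsCapacious.exists_finite_subset [ContinuousConstSMul ℂ E] {D : Set E}
    (h : IsCapacious D) (h1 : Convex ℝ D) (h2 : Balanced ℂ D) {S : Set E} (hS : IsTotBdd S) :
    ∃ F ⊆ S, F.Finite ∧ ∀ x ∈ S, ∃ y ∈ F, x - y ∈ D := by
  obtain ⟨F, hF, hSF⟩ := h _ (hS.smul 2)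
  have : ∀ x ∈ S, ∃ y ∈ F, (2 : ℂ) • x - y ∈ D := by
    intro x hx
    obtain ⟨d, hd, y, hy, hdy⟩ := hSF ⟨x, hx, rfl⟩
    refine ⟨y, hy, ?_⟩
    have : d + y = (2 : ℂ) • x := hdy
    rwa [← this, add_sub_cancel_right]
  choose! c hcF hcD using this
  obtain ⟨A, hA, hfin, hAc⟩ := exists_finite_subset_image_eq (A := S) (c := c)
    (hF.subset (by rintro _ ⟨x, hx, rfl⟩; exact hcF x hx))
  refine ⟨A, hA, hfin, fun x hx => ?_⟩
  obtain ⟨y, hy, hxy⟩ := hAc x hx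
  refine ⟨y, hy, ?_⟩
  have := half_sub_mem h1 h2 (hcD x hx) (hcD y (hA hy))
  rwa [hxy, sub_sub_sub_cancel_right, ← smul_sub, inv_smul_smul₀ two_ne_zero] at this

end LocallyConvex

/-! ### Behaviour of the projective series on totally bounded sets and on Cauchy filters. -/

section Topologies

variable {E : Type u} [AddCommGroup E] [Module ℂ E]

/-- If the trace of `s` at zero on `t`-totally bounded sets is not finer than that of `t`,
then `t`-totally bounded sets are `s`-totally bounded. -/
theorem isTotBdd_of_nhds_inf_principal_le {t s : TopologicalSpace E} (ht : IsLC t)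
    (h : ∀ K : Set E, @IsTotBdd E _ t K → @nhds E t 0 ⊓ 𝓟 K ≤ @nhds E s 0) {K : Set E}
    (hK : @IsTotBdd E _ t K) : @IsTotBdd E _ s K := by
  have := ht.1
  refine @isTotBdd_of_exists E _ s K fun U hU => ?_
  -- The hypothesis is used for `K - K`, which contains every `x - y` with `x` and the centre `y` in
  -- `K`.
  obtain ⟨F, hFK, hF, hKF⟩ := @IsTotBdd.exists_finite_subset E _ t _ K hK _
    (mem_inf_principal.1 (h (K - K) (@IsTotBdd.sub E _ t _ K K hK hK) hU))
  refine ⟨F, hF, fun x hx => ?_⟩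
  obtain ⟨y, hy, hxy⟩ := hKF x hx
  exact ⟨y, hy, hxy (Set.sub_mem_sub hx (hFK hy))⟩

/-- On a totally bounded set, the step of the projective series does not change the trace
at zero of the topology. -/
theorem nhds_inf_principal_le_psStep [t : TopologicalSpace E] [IsTopologicalAddGroup E]
    [ContinuousSMul ℂ E] {K : Set E} (hK : IsTotBdd K) : 𝓝 (0 : E) ⊓ 𝓟 K ≤ @nhds E (psStep t) 0 := by
  refine hasBasis_nhds_zero_psStep.ge_iff.2 ?_
  rintro D ⟨hD0, hD1, hD2, hD3⟩
  obtain ⟨F, hFK, hF, hKF⟩ := hD3.exists_finite_subset hD1 hD2 (hK.smul 2)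
  -- `C` is closed and misses zero. A point `x` of `K` outside `C` has a centre `a` for `2x` with
  -- `-a ∈ D`, whence `x = ((2x - a) - (-a)) / 2` lies in `D`.
  let C : Set E := ⋃ a ∈ {a ∈ F | -a ∉ D}, {x | (2 : ℂ) • x - a ∈ D}
  have hC : IsClosed C := (hF.sep _).isClosed_biUnion fun a _ =>
    hD0.preimage ((continuous_const_smul (2 : ℂ)).sub continuous_const)
  have h0 : (0 : E) ∉ C := by
    simp only [C, Set.mem_iUnion, not_exists]
    intro a ha h
    exact ha.2 (by simpa using h)
  refine mem_inf_principal.2 ?_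
  filter_upwards [hC.isOpen_compl.mem_nhds h0] with x hxC hxK
  obtain ⟨a, ha, hxa⟩ := hKF _ ⟨x, hxK, rfl⟩
  have haD : -a ∈ D := by
    by_contra h
    exact hxC (Set.mem_biUnion (show a ∈ {a ∈ F | -a ∉ D} from ⟨ha, h⟩) hxa)
  have := half_sub_mem hD1 hD2 hxa haD
  have h2 : (2 : ℂ)⁻¹ • ((fun x => (2 : ℂ) • x) x - a - -a) = x := by
    rw [sub_neg_eq_add, sub_add_cancel, inv_smul_smul₀ two_ne_zero]
  rwa [h2] at this

/-- The induction runs over all `K` at once: at a successor, the hypothesis for all `K` shows that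
`K` is still totally bounded at stage `μ`, which the one-step lemma requires. -/
theorem nhds_inf_principal_le_projSeries {t : TopologicalSpace E} (ht : IsLC t) (μ : Ordinal.{u})
    (K : Set E) (hK : @IsTotBdd E _ t K) :
    @nhds E t 0 ⊓ 𝓟 K ≤ @nhds E (projSeries t μ) 0 := by
  induction μ using Ordinal.limitRecOn generalizing K with
  | zero => rw [projSeries_zero]; exact inf_le_left
  | add_one μ ih =>
    have hs := ht.projSeries μ
    have := hs.1
    have := hs.2.1
    rw [projSeries_add_one]
    exact (le_inf (ih K hK) inf_le_right).trans (@nhds_inf_principal_le_psStep E _ _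
      (projSeries t μ) _ _ K (isTotBdd_of_nhds_inf_principal_le ht ih hK))
  | limit μ hμ ih =>
    rw [projSeries_limit t μ hμ, nhds_iInf]
    exact le_iInf fun κ => ih κ.1 κ.2 K hK

theorem nhds_inf_principal_le_psTopology {t : TopologicalSpace E} (ht : IsLC t) {K : Set E}
    (hK : @IsTotBdd E _ t K) : @nhds E t 0 ⊓ 𝓟 K ≤ @nhds E (psTopology t) 0 := by
  rw [nhds_iInf]
  exact le_iInf fun μ => nhds_inf_principal_le_projSeries ht μ K hK

/-- A filter which converges for `s` and is Cauchy for the step of the projective series,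
converges for this step. -/
theorem le_nhds_psStep [s : TopologicalSpace E] [IsTopologicalAddGroup E]
    [ContinuousSMul ℂ E] {f : Filter E} [f.NeBot] {x : E} (hx : f ≤ 𝓝 x)
    (hf : ∀ U ∈ @nhds E (psStep s) 0, ∃ A ∈ f, ∀ x ∈ A, ∀ y ∈ A, x - y ∈ U) :
    f ≤ @nhds E (psStep s) x := by
  have hg := (IsLC.psStep s).1
  rw [← @map_add_left_nhds_zero E (psStep s)]
  refine (hasBasis_nhds_zero_psStep.map _).ge_iff.2 ?_
  rintro D ⟨hD0, hD1, hD2, hD3⟩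
  obtain ⟨A, hA, hAD⟩ := hf D (hasBasis_nhds_zero_psStep.mem_of_mem ⟨hD0, hD1, hD2, hD3⟩)
  refine mem_of_superset hA fun a ha => ⟨a - x, ?_, add_sub_cancel x a⟩
  -- `D` is a neighbourhood for the new topology but closed for the old one, so `y` in `a - y ∈ D`
  -- may tend to `x` in the old one.
  refine hD0.mem_of_tendsto (b := f) (f := fun y => a - y)
    ((continuous_const.sub continuous_id).tendsto x |>.mono_left hx) ?_
  filter_upwards [hA] with y hy using hAD a ha y hy

/-- The Cauchy condition for the final topology implies the one at every stage, so convergence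
climbs the projective series. -/
theorem le_nhds_psTopology {t : TopologicalSpace E} (ht : IsLC t) {f : Filter E} [f.NeBot] {x : E}
    (hx : f ≤ @nhds E t x)
    (hf : ∀ U ∈ @nhds E (psTopology t) 0, ∃ A ∈ f, ∀ x ∈ A, ∀ y ∈ A, x - y ∈ U) :
    f ≤ @nhds E (psTopology t) x := by
  rw [nhds_iInf]
  refine le_iInf fun μ => ?_
  induction μ using Ordinal.limitRecOn with
  | zero => rwa [projSeries_zero]
  | add_one μ ih =>
    have hs := ht.projSeries μ
    have := hs.1
    have := hs.2.1
    rw [projSeries_add_one]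
    refine @le_nhds_psStep E _ _ (projSeries t μ) _ _ f _ x ih fun U hU => hf U ?_
    rw [← projSeries_add_one] at hU
    exact nhds_mono (iInf_le (projSeries t) _) hU
  | limit μ hμ ih =>
    rw [projSeries_limit t μ hμ, nhds_iInf]
    exact le_iInf fun κ => ih κ.1 κ.2

theorem psStep_eq_self [t : TopologicalSpace E] [h1 : IsTopologicalAddGroup E]
    [h2 : ContinuousSMul ℂ E] [h3 : LocallyConvexSpace ℝ E] (h : IsPseudosaturated E) :
    psStep t = t := by
  refine le_antisymm (psStep_le ⟨h1, h2, h3⟩) ?_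
  have hg := (IsLC.psStep t).1
  have h0 : 𝓝 (0 : E) ≤ @nhds E (psStep t) 0 := hasBasis_nhds_zero_psStep.ge_iff.2
    fun D hD => h D hD.1 hD.2.1 hD.2.2.1 hD.2.2.2
  refine le_of_nhds_le_nhds fun x => ?_
  rw [← map_add_left_nhds_zero, ← @map_add_left_nhds_zero E (psStep t)]
  exact map_mono h0

theorem psTopology_eq_self [t : TopologicalSpace E] [h1 : IsTopologicalAddGroup E]
    [h2 : ContinuousSMul ℂ E] [h3 : LocallyConvexSpace ℝ E] (h : IsPseudosaturated E) :
    psTopology t = t := by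
  refine le_antisymm (psTopology_le t) (le_iInf fun μ => ?_)
  induction μ using Ordinal.limitRecOn with
  | zero => rw [projSeries_zero]
  | add_one μ ih =>
    have : projSeries t μ = t :=
      le_antisymm ((projSeries_antitone ⟨h1, h2, h3⟩ zero_le).trans (projSeries_zero t).le) ih
    rw [projSeries_add_one, this, psStep_eq_self h]
  | limit μ hμ ih =>
    rw [projSeries_limit t μ hμ]
    exact le_iInf fun κ => ih κ.1 κ.2

end Topologies

/-! ### The pseudosaturation as a space. -/

namespace PsSat

variable {E : Type u} [AddCommGroup E] [Module ℂ E] [t : TopologicalSpace E]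

/-- The identity of the set `E`, as a map to the pseudosaturation. -/
def ofBase : E ≃ₗ[ℂ] PsSat E := LinearEquiv.refl ℂ E

theorem toBase_injective : Function.Injective (toBase E) := fun _ _ h => h

instance [T2Space E] : T2Space (PsSat E) :=
  T2Space.of_injective_continuous toBase_injective (toBase E).continuous

section LC

variable [h1 : IsTopologicalAddGroup E] [h2 : ContinuousSMul ℂ E] [h3 : LocallyConvexSpace ℝ E]

/-- On a totally bounded set, the pseudosaturation does not change the trace of the topology
at zero. -/
theorem exists_nhds_of_isTotBdd {K : Set E} (hK : IsTotBdd K) {U : Set (PsSat E)}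
    (hU : U ∈ 𝓝 0) : ∃ W ∈ 𝓝 (0 : E), ∀ x ∈ K, x ∈ W → ofBase x ∈ U := by
  exact ⟨_, mem_inf_principal.1
    (nhds_inf_principal_le_psTopology (E := E) ⟨h1, h2, h3⟩ hK hU), fun x hx hxW => hxW hx⟩

/-- The filter stays Cauchy and totally bounded in the coarser topology of `E`, so it converges
there, and `le_nhds_psTopology` upgrades the convergence. -/
theorem _root_.Ster.IsPseudocomplete.psSat (h : IsPseudocomplete E) : IsPseudocomplete (PsSat E) := by
  refine isPseudocomplete_iff.2 fun f hne hf hS => ?_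
  have hlc : IsLC t := ⟨h1, h2, h3⟩
  obtain ⟨S, hSf, hS⟩ := hS
  obtain ⟨x, hx⟩ := isPseudocomplete_iff.1 h (Filter.map (toBase E) f) inferInstance (fun U hU => by
      obtain ⟨A, hA, hAU⟩ := hf (toBase E ⁻¹' U)
        ((toBase E).continuous.continuousAt.preimage_mem_nhds (by simpa using hU))
      refine ⟨toBase E '' A, image_mem_map hA, ?_⟩
      rintro _ ⟨a, ha, rfl⟩ _ ⟨b, hb, rfl⟩
      simpa using hAU a ha b hb)
    ⟨toBase E '' S, image_mem_map hSf, hS.image (toBase E : PsSat E →+ E) (toBase E).continuous⟩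
  exact ⟨ofBase x, @le_nhds_psTopology E _ _ t hlc f hne _ hx hf⟩

/-- The identity map from a pseudosaturated space to its pseudosaturation. -/
def ofPseudosaturated (h : IsPseudosaturated E) : E →L[ℂ] PsSat E where
  toLinearMap := (ofBase : E ≃ₗ[ℂ] PsSat E)
  cont := continuous_id_of_le (psTopology_eq_self h).ge

end LC

end PsSat

/-! ### Spaces of operators: equicontinuity, Ascoli's argument, pseudocompleteness. -/

namespace PrimFrac

section Basic

variable {F : Type v} {E : Type u} [AddCommGroup F] [Module ℂ F] [TopologicalSpace F]
  [IsTopologicalAddGroup F] [ContinuousSMul ℂ F]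
  [AddCommGroup E] [Module ℂ E] [TopologicalSpace E]

theorem hasBasis_nhds_zero_of_basis {ι : Type*} {p : ι → Prop} {b : ι → Set F}
    (h : (𝓝 (0 : F)).HasBasis p b) : (𝓝 (0 : PrimFrac F E)).HasBasis
      (fun Si : Set E × ι => IsTotBdd Si.1 ∧ p Si.2) fun Si => {f | ∀ x ∈ Si.1, f x ∈ b Si.2} :=
  UniformConvergenceCLM.hasBasis_nhds_zero_of_basis _ _ _ ⟨∅, fun _ _ => ⟨∅, by simp⟩⟩
    (directedOn_of_sup_mem fun _ _ hS hT => hS.union hT) h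

theorem mapsTo_mem_nhds {T : Set E} (hT : IsTotBdd T) {U : Set F} (hU : U ∈ 𝓝 0) :
    {f : PrimFrac F E | ∀ x ∈ T, f x ∈ U} ∈ 𝓝 0 :=
  (hasBasis_nhds_zero_of_basis (𝓝 (0 : F)).basis_sets).mem_of_mem (i := (T, U)) ⟨hT, hU⟩

variable (F) in
/-- The evaluation of operators at a point. -/
noncomputable def eval (x : E) : PrimFrac F E →L[ℂ] F where
  toFun f := f x
  map_add' _ _ := rfl
  map_smul' _ _ := rfl
  cont := (UniformConvergenceCLM.continuousEvalConst (RingHom.id ℂ) F _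
    (Set.eq_univ_of_forall fun x => ⟨{x}, isTotBdd_singleton x, rfl⟩)).continuous_eval_const x

instance [T2Space F] : T2Space (PrimFrac F E) :=
  UniformConvergenceCLM.t2Space _ _ _
    (Set.eq_univ_of_forall fun x => ⟨{x}, isTotBdd_singleton x, rfl⟩)

theorem sub_apply (f g : PrimFrac F E) (x : E) : (f - g) x = f x - g x := rfl

end Basic

section LC

variable {F : Type v} {E : Type u} [AddCommGroup F] [Module ℂ F] [TopologicalSpace F]
  [IsTopologicalAddGroup F] [ContinuousSMul ℂ F] [LocallyConvexSpace ℝ F]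
  [AddCommGroup E] [Module ℂ E] [TopologicalSpace E]

/-- On a totally bounded `T`, the set `A` is approximated by a finite subset, and a finite set of
operators is equicontinuous; then `f (x - y) = (f - g) x + g (x - y) - (f - g) y`. -/
theorem isCapacious_setOf_forall_mem [IsTopologicalAddGroup E] {A : Set (PrimFrac F E)}
    (hA : IsTotBdd A) {U : Set F} (hU : U ∈ 𝓝 0) : IsCapacious {x | ∀ f ∈ A, f x ∈ U} := by
  refine isCapacious_of_exists fun T hT => ?_
  obtain ⟨V, hV, -, hVU⟩ := exists_nhds_zero_add_add_sub hU
  obtain ⟨A', hAA', hfin, hA'⟩ := hA.exists_finite_subset (mapsTo_mem_nhds hT hV)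
  have hD : {x : E | ∀ g ∈ A', g x ∈ V} ∈ 𝓝 0 := by
    have : {x : E | ∀ g ∈ A', g x ∈ V} = ⋂ g ∈ A', g ⁻¹' V := by ext; simp
    rw [this]
    exact (biInter_mem hfin).2 fun g _ =>
      (map_continuous g).continuousAt.preimage_mem_nhds (by simpa using hV)
  obtain ⟨B, hBT, hB, h⟩ := hT.exists_finite_subset hD
  refine ⟨B, hB, fun x hx => ?_⟩
  obtain ⟨y, hy, hxy⟩ := h x hx
  refine ⟨y, hy, fun f hf => ?_⟩
  obtain ⟨g, hg, hfg⟩ := hA' f hf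
  have := hVU _ (hfg x hx) _ (hxy g hg) _ (hfg y (hBT hy))
  convert this using 1
  rw [sub_apply, sub_apply, map_sub, map_sub]
  abel

theorem setOf_forall_mem_closed_convex_balanced (A : Set (PrimFrac F E)) {U : Set F}
    (h0 : IsClosed U) (h1 : Convex ℝ U) (h2 : Balanced ℂ U) :
    IsClosed {x : E | ∀ f ∈ A, f x ∈ U} ∧ Convex ℝ {x : E | ∀ f ∈ A, f x ∈ U} ∧
      Balanced ℂ {x : E | ∀ f ∈ A, f x ∈ U} := by
  refine ⟨?_, ?_, ?_⟩
  · simp only [Set.ofPred_forall]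
    exact isClosed_biInter fun f _ => h0.preimage (map_continuous f)
  · intro x hx y hy a b ha hb hab f hf
    have := h1 (hx f hf) (hy f hf) ha hb hab
    rw [← Complex.coe_smul, ← Complex.coe_smul, map_add, map_smul, map_smul, Complex.coe_smul,
      Complex.coe_smul]
    exact this
  · rintro c hc _ ⟨x, hx, rfl⟩ f hf
    have := h2 c hc ⟨_, hx f hf, rfl⟩
    simpa using this

/-- A totally bounded set of operators on a pseudosaturated space is equicontinuous. -/
theorem setOf_forall_mem_nhds [IsTopologicalAddGroup E] (hE : IsPseudosaturated E)
    {A : Set (PrimFrac F E)} (hA : IsTotBdd A) {U : Set F} (hU : U ∈ 𝓝 0) :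
    {x | ∀ f ∈ A, f x ∈ U} ∈ 𝓝 0 := by
  obtain ⟨V, ⟨hV, h0, h1, h2⟩, hVU⟩ := hasBasis_nhds_zero_closed_convex_balanced.mem_iff.1 hU
  obtain ⟨h0', h1', h2'⟩ := setOf_forall_mem_closed_convex_balanced A h0 h1 h2
  exact mem_of_superset (hE _ h0' h1' h2' (isCapacious_setOf_forall_mem hA hV))
    fun x hx f hf => hVU (hx f hf)

/-- A family of additive maps which is equicontinuous, and pointwise totally bounded on a totally
bounded set `T`, is approximated uniformly on `T` by a finite subfamily. -/
theorem exists_finite_of_equicontinuous [IsTopologicalAddGroup E] {α : Type*} (e : α → E →+ F)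
    {A : Set α} {T : Set E} (hT : IsTotBdd T)
    (h1 : ∀ U ∈ 𝓝 (0 : F), {x | ∀ a ∈ A, e a x ∈ U} ∈ 𝓝 0)
    (h2 : ∀ x ∈ T, IsTotBdd ((fun a => e a x) '' A)) {U : Set F} (hU : U ∈ 𝓝 0) :
    ∃ A' ⊆ A, A'.Finite ∧ ∀ a ∈ A, ∃ a' ∈ A', ∀ x ∈ T, e a x - e a' x ∈ U := by
  obtain ⟨V, hV, -, hVU⟩ := exists_nhds_zero_add_add_sub hU
  obtain ⟨B, hBT, hB, hTB⟩ := hT.exists_finite_subset (h1 V hV)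
  obtain ⟨A', hA', hfin, h⟩ := exists_finite_forall_sub_mem hB (fun x a => e a x)
    (fun x hx => h2 x (hBT hx)) hV
  refine ⟨A', hA', hfin, fun a ha => ?_⟩
  obtain ⟨a', ha', haa'⟩ := h a ha
  refine ⟨a', ha', fun x hx => ?_⟩
  obtain ⟨y, hy, hxy⟩ := hTB x hx
  -- The three terms are `e a (x - y)`, `e a y - e a' y` and `e a' (x - y)`.
  have := hVU _ (hxy a ha) _ (haa' y hy) _ (hxy a' (hA' ha'))
  convert this using 1
  rw [map_sub, map_sub]
  abel

/-- Ascoli's theorem for operators; it serves to show that polars are totally bounded. -/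
theorem isTotBdd_of_equicontinuous [IsTopologicalAddGroup E] {A : Set (PrimFrac F E)}
    (h1 : ∀ U ∈ 𝓝 (0 : F), {x | ∀ f ∈ A, f x ∈ U} ∈ 𝓝 0)
    (h2 : ∀ x, IsTotBdd ((fun f => f x) '' A)) : IsTotBdd A := by
  refine isTotBdd_of_exists fun W hW => ?_
  obtain ⟨⟨T, U⟩, ⟨hT, hU⟩, hTU⟩ := (hasBasis_nhds_zero_of_basis (𝓝 (0 : F)).basis_sets).mem_iff.1 hW
  obtain ⟨A', -, hfin, h⟩ := exists_finite_of_equicontinuous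
    (fun f : PrimFrac F E => (AddMonoidHomClass.toAddMonoidHom f : E →+ F)) hT h1
    (fun x _ => h2 x) hU
  refine ⟨A', hfin, fun f hf => ?_⟩
  obtain ⟨g, hg, hfg⟩ := h f hf
  exact ⟨g, hg, hTU hfg⟩

/-- The set of values of a totally bounded set of operators on a totally bounded set is totally
bounded. -/
theorem isTotBdd_image2 [IsTopologicalAddGroup E] {A : Set (PrimFrac F E)} (hA : IsTotBdd A)
    {T : Set E} (hT : IsTotBdd T) : IsTotBdd {y | ∃ f ∈ A, ∃ x ∈ T, f x = y} := by
  refine isTotBdd_of_exists fun U hU => ?_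
  obtain ⟨V, hV, hVU⟩ := exists_nhds_zero_half hU
  obtain ⟨A', -, hfin, hA'⟩ := hA.exists_finite_subset (mapsTo_mem_nhds hT hV)
  have hg : ∀ g : PrimFrac F E, ∃ B : Set F, B.Finite ∧ ∀ x ∈ T, ∃ y ∈ B, g x - y ∈ V := by
    intro g
    obtain ⟨B, -, hB, h⟩ := (hT.image (AddMonoidHomClass.toAddMonoidHom g : E →+ F)
      (map_continuous g)).exists_finite_subset hV
    exact ⟨B, hB, fun x hx => h _ ⟨x, hx, rfl⟩⟩
  choose B hB hBV using hg
  refine ⟨⋃ g ∈ A', B g, hfin.biUnion fun g _ => hB g, ?_⟩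
  rintro _ ⟨f, hf, x, hx, rfl⟩
  obtain ⟨g, hg, hfg⟩ := hA' f hf
  obtain ⟨y, hy, hxy⟩ := hBV g x hx
  refine ⟨y, Set.mem_biUnion hg hy, ?_⟩
  have := hVU _ (hfg x hx) _ hxy
  rwa [sub_apply, sub_add_sub_cancel] at this

/-- The space of operators from a pseudosaturated space to a pseudocomplete one is
pseudocomplete. -/
theorem isPseudocomplete [IsTopologicalAddGroup E] [T2Space F] (hE : IsPseudosaturated E)
    (hF : IsPseudocomplete F) : IsPseudocomplete (PrimFrac F E) := by
  refine isPseudocomplete_iff.2 fun f hne hf ⟨S, hSf, hS⟩ => ?_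
  have hlim : ∀ x : E, ∃ y, Tendsto (fun g : PrimFrac F E => g x) f (𝓝 y) := by
    intro x
    refine isPseudocomplete_iff.1 hF (Filter.map (eval F x) f) inferInstance (fun U hU => ?_)
      ⟨_, image_mem_map hSf, hS.image (eval F x : PrimFrac F E →+ F) (eval F x).continuous⟩
    obtain ⟨A, hA, hAU⟩ := hf (eval F x ⁻¹' U)
      ((eval F x).continuous.continuousAt.preimage_mem_nhds (by simpa using hU))
    refine ⟨_, image_mem_map hA, ?_⟩
    rintro _ ⟨a, ha, rfl⟩ _ ⟨b, hb, rfl⟩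
    simpa using hAU a ha b hb
  choose g hg using hlim
  let G : E →ₗ[ℂ] F :=
    { toFun := g
      map_add' := fun x y => tendsto_nhds_unique (hg (x + y)) (((hg x).add (hg y)).congr
        fun h => (map_add h x y).symm)
      map_smul' := fun c x => tendsto_nhds_unique (hg (c • x)) (((hg x).const_smul c).congr
        fun h => (map_smul h c x).symm) }
  have hG : Continuous G := by
    refine continuous_of_continuousAt_zero G ?_
    rw [ContinuousAt, map_zero]
    refine hasBasis_nhds_zero_closed_convex_balanced.ge_iff.2 fun U hU => ?_
    -- The totally bounded member `S` of the filter is equicontinuous, and a bound by the closed set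
    -- `U` survives the pointwise limit.
    refine mem_map.2 (mem_of_superset (setOf_forall_mem_nhds hE hS hU.1) fun x hx => ?_)
    exact hU.2.1.mem_of_tendsto (hg x) (mem_of_superset hSf fun h hh => hx h hh)
  let G' : PrimFrac F E := (⟨G, hG⟩ : E →L[ℂ] F)
  refine ⟨G', ?_⟩
  rw [← map_add_left_nhds_zero]
  refine ((hasBasis_nhds_zero_of_basis hasBasis_nhds_zero_closed_convex_balanced).map _).ge_iff.2 ?_
  rintro ⟨T, U⟩ ⟨hT, hU⟩
  obtain ⟨A, hA, hAU⟩ := hf _ (mapsTo_mem_nhds hT hU.1)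
  refine mem_of_superset hA fun h hh => ⟨h - G', fun x hx => ?_, add_sub_cancel G' h⟩
  refine hU.2.1.mem_of_tendsto (tendsto_const_nhds.sub (hg x)) ?_
  filter_upwards [hA] with k hk using hAU h hh k hk x hx

end LC

end PrimFrac

/-! ### Separation by functionals. -/

section Bipolar

variable {E : Type u} [AddCommGroup E] [Module ℂ E] [TopologicalSpace E]
  [IsTopologicalAddGroup E] [ContinuousSMul ℂ E] [LocallyConvexSpace ℝ E]

/-- The bipolar theorem, in the form of the separation of a point from a closed convex
balanced set. -/
theorem exists_norm_le_one_lt_norm {U : Set E} (h0 : IsClosed U) (h1 : Convex ℝ U)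
    (h2 : Balanced ℂ U) (hne : (0 : E) ∈ U) {x : E} (hx : x ∉ U) :
    ∃ f : E →L[ℂ] ℂ, (∀ y ∈ U, ‖f y‖ ≤ 1) ∧ 1 < ‖f x‖ := by
  obtain ⟨f, r, hf, hr⟩ := RCLike.geometric_hahn_banach_closed_point (𝕜 := ℂ) h1 h0 hx
  have hr0 : 0 < r := by simpa using hf 0 hne
  have hr' : ‖(r : ℂ)⁻¹‖ = r⁻¹ := by simp [abs_of_pos hr0]
  refine ⟨(r : ℂ)⁻¹ • f, fun y hy => ?_, ?_⟩
  · rw [smul_apply, norm_smul, hr', inv_mul_le_one₀ hr0]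
    -- Rotating `y` inside the balanced set turns the bound on the real part into a bound on the
    -- norm.
    obtain ⟨c, hc, hcy⟩ := RCLike.exists_norm_eq_mul_self (f y)
    have h := hf (c • y) (h2.smul_mem hc.le hy)
    rw [map_smul, smul_eq_mul, ← hcy] at h
    exact le_of_lt (by simpa using h)
  · rw [smul_apply, norm_smul, hr', ← div_eq_inv_mul, one_lt_div hr0]
    exact hr.trans_le (RCLike.re_le_norm _)

end Bipolar

/-- A continuous linear functional on a power of `ℂ` depends on finitely many coordinates. -/
theorem exists_eq_sum_of_pi {ι : Type*} (φ : (ι → ℂ) →L[ℂ] ℂ) :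
    ∃ c : ι →₀ ℂ, ∀ v, φ v = c.sum fun i a => a * v i := by
  have : (φ : (ι → ℂ) →ₗ[ℂ] ℂ) ∈ Submodule.span ℂ
      (Set.range fun i : ι => (LinearMap.proj i : (ι → ℂ) →ₗ[ℂ] ℂ)) :=
    (LinearMap.mem_span_iff_continuous _).2 φ.continuous
  obtain ⟨c, hc⟩ := Finsupp.mem_span_range_iff_exists_finsupp.1 this
  refine ⟨c, fun v => ?_⟩
  have := DFunLike.congr_fun hc v
  rw [← ContinuousLinearMap.coe_coe, ← this]
  simp [Finsupp.sum]

/-! ### Stereotypy of pseudosaturated pseudocomplete spaces. -/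

section Stereotype

variable {E : Type u} [AddCommGroup E] [Module ℂ E] [TopologicalSpace E]
  [IsTopologicalAddGroup E] [ContinuousSMul ℂ E] [LocallyConvexSpace ℝ E]

/-- The natural map from `E` to its second dual, as a linear map. -/
noncomputable def bidual : E →ₗ[ℂ] StarDual (StarDual E) where
  toFun x := PrimFrac.eval ℂ x
  map_add' x y := UniformConvergenceCLM.ext _ _ fun f => map_add f x y
  map_smul' c x := UniformConvergenceCLM.ext _ _ fun f => map_smul f c x

/-- This is precisely the equicontinuity of totally bounded sets of functionals. -/
theorem continuous_bidual (hE : IsPseudosaturated E) :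
    Continuous (bidual : E →ₗ[ℂ] StarDual (StarDual E)) := by
  refine continuous_of_continuousAt_zero bidual ?_
  rw [ContinuousAt, map_zero]
  refine (PrimFrac.hasBasis_nhds_zero_of_basis (𝓝 (0 : ℂ)).basis_sets).ge_iff.2 ?_
  rintro ⟨K, V⟩ ⟨hK, hV⟩
  exact mem_map.2 (PrimFrac.setOf_forall_mem_nhds hE hK hV)

theorem isTotBdd_of_norm_le (r : ℝ) {S : Set ℂ} (hS : ∀ z ∈ S, ‖z‖ ≤ r) : IsTotBdd S :=
  ((isTotBdd_iff_totallyBounded _).2 (isCompact_closedBall (0 : ℂ) r).totallyBounded).mono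
    fun z hz => by simpa using hS z hz

/-- The polar is equicontinuous by scaling `U`, and pointwise bounded in `ℂ` because `U` is
absorbent. -/
theorem isTotBdd_polar {U : Set E} (hU : U ∈ 𝓝 0) :
    IsTotBdd {f : StarDual E | ∀ x ∈ U, ‖f x‖ ≤ 1} := by
  refine PrimFrac.isTotBdd_of_equicontinuous (fun V hV => ?_) fun x => ?_
  · obtain ⟨ε, hε, hεV⟩ := Metric.mem_nhds_iff.1 hV
    have h2 : ((ε / 2 : ℝ) : ℂ) ≠ 0 := by exact_mod_cast (half_pos hε).ne'
    refine mem_of_superset ((set_smul_mem_nhds_zero_iff h2).2 hU) ?_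
    rintro _ ⟨x, hx, rfl⟩ f hf
    refine hεV ?_
    have h3 : f (((ε / 2 : ℝ) : ℂ) • x) = ((ε / 2 : ℝ) : ℂ) * f x := map_smul f _ x
    rw [mem_ball_zero_iff]
    change ‖f (((ε / 2 : ℝ) : ℂ) • x)‖ < ε
    rw [h3, norm_mul, Complex.norm_real, Real.norm_of_nonneg (half_pos hε).le]
    nlinarith [hf x hx]
  · obtain ⟨r, hr, h⟩ := ((absorbent_nhds_zero (𝕜 := ℂ) hU).absorbs (x := x)).exists_pos
    obtain ⟨y, hy, hyx⟩ := h (r : ℂ) (by simp [abs_of_pos hr]) rfl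
    refine isTotBdd_of_norm_le r ?_
    rintro _ ⟨f, hf, rfl⟩
    have h3 : f x = (r : ℂ) * f y := by rw [← hyx]; exact map_smul f _ y
    change ‖f x‖ ≤ r
    rw [h3, norm_mul, Complex.norm_real, Real.norm_of_nonneg hr.le]
    exact mul_le_of_le_one_right hr.le (hf y hy)

theorem mem_of_forall_polar {U : Set E} (h0 : IsClosed U) (h1 : Convex ℝ U)
    (h2 : Balanced ℂ U) (hne : (0 : E) ∈ U) {x : E}
    (hx : ∀ f : StarDual E, (∀ x ∈ U, ‖f x‖ ≤ 1) → ‖f x‖ ≤ 1) : x ∈ U := by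
  by_contra h
  obtain ⟨f, hf, hfx⟩ := exists_norm_le_one_lt_norm h0 h1 h2 hne h
  exact hfx.not_ge (hx f hf)

/-- By the bipolar theorem a closed convex balanced `U` is recovered from its polar, which is one of
the totally bounded sets defining the topology of the second dual. -/
theorem comap_bidual_nhds_zero_le :
    comap (bidual : E →ₗ[ℂ] StarDual (StarDual E)) (𝓝 0) ≤ 𝓝 0 := by
  refine hasBasis_nhds_zero_closed_convex_balanced.ge_iff.2 ?_
  rintro U ⟨hU, h0, h1, h2⟩
  refine ⟨_, PrimFrac.mapsTo_mem_nhds (isTotBdd_polar hU) (Metric.closedBall_mem_nhds 0 one_pos),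
    fun x hx => mem_of_forall_polar h0 h1 h2 (mem_of_mem_nhds hU) fun f hf => ?_⟩
  have := hx f hf
  rwa [mem_closedBall_zero_iff] at this

/-- Closed totally bounded sets of a pseudocomplete space are compact. -/
theorem IsPseudocomplete.isCompact (hE : IsPseudocomplete E) {T : Set E} (hT : IsTotBdd T)
    (hc : IsClosed T) : IsCompact T := by
  let := IsTopologicalAddGroup.rightUniformSpace E
  have : IsUniformAddGroup E := isUniformAddGroup_of_addCommGroup
  refine isCompact_iff_totallyBounded_isComplete.2 ⟨(isTotBdd_iff_totallyBounded T).1 hT, ?_⟩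
  intro f hf hfT
  obtain ⟨x, hx⟩ := hE f hf ⟨T, le_principal_iff.1 hfT, hT⟩
  have := hf.1
  exact ⟨x, hc.mem_of_tendsto (f := id) (b := f) hx (le_principal_iff.1 hfT), hx⟩

/-- The closed absolutely convex hull of `S` over `ℝ` is still totally bounded, hence compact. -/
theorem IsPseudocomplete.exists_isCompact (hE : IsPseudocomplete E) {S : Set E}
    (hS : IsTotBdd S) : ∃ T : Set E, IsCompact T ∧ Convex ℝ T ∧ Balanced ℝ T ∧ S ⊆ T := by
  have : ContinuousSMul ℝ E := IsScalarTower.continuousSMul ℂ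
  let := IsTopologicalAddGroup.rightUniformSpace E
  have : IsUniformAddGroup E := isUniformAddGroup_of_addCommGroup
  have hT := ((isTotBdd_iff_totallyBounded S).1 hS).absConvexHull.closure
  have hac : AbsConvex ℝ (closure (absConvexHull ℝ S)) := absConvex_absConvexHull.closure
  exact ⟨_, hE.isCompact ((isTotBdd_iff_totallyBounded _).2 hT) isClosed_closure, hac.2, hac.1,
    subset_absConvexHull.trans subset_closure⟩

/-- Mackey–Arens argument. The functional `ξ` is controlled by a totally bounded `S`, which is
enlarged to a compact convex `T`. If `ξ`, as a point of the power `StarDual E → ℂ`, were outside the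
compact image of `T`, a separating functional would depend on finitely many coordinates, so it would
be evaluation at one `f`, for which `ξ f` is too large. -/
theorem bidual_surjective (hE : IsPseudocomplete E) :
    Function.Surjective (bidual : E →ₗ[ℂ] StarDual (StarDual E)) := by
  intro ξ
  have hξ : {f : StarDual E | ‖ξ f‖ ≤ 1} ∈ 𝓝 0 := by
    have := (map_continuous ξ).continuousAt.preimage_mem_nhds (x := 0)
      (t := Metric.closedBall (0 : ℂ) 1) (by
        rw [map_zero]; exact Metric.closedBall_mem_nhds 0 one_pos)
    filter_upwards [this] with f hf
    simpa using hf
  obtain ⟨⟨S, r⟩, ⟨hS, hr : 0 < r⟩, hSr⟩ :=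
    (PrimFrac.hasBasis_nhds_zero_of_basis Metric.nhds_basis_closedBall).mem_iff.1 hξ
  -- `T` is balanced only over `ℝ`, so multiples of `S` by `2 / r` and `2i / r` are put in to
  -- control real and imaginary parts; the factor `2` pays for adding the two estimates. The point
  -- `0` forces `u > 0`.
  obtain ⟨T, hT, hT1, hT2, hST⟩ := hE.exists_isCompact
    (((hS.smul (2 / r)).union (hS.smul (2 * Complex.I / r))).union (isTotBdd_singleton 0))
  let j : E → StarDual E → ℂ := fun x f => f x
  have hj : Continuous j := continuous_pi fun f => map_continuous f
  have hjT : Convex ℝ (j '' T) := by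
    rintro _ ⟨x, hx, rfl⟩ _ ⟨y, hy, rfl⟩ a b ha hb hab
    refine ⟨_, hT1 hx hy ha hb hab, ?_⟩
    funext f
    have h1 : f (a • x + b • y) = (a : ℂ) * f x + b * f y := by
      rw [← Complex.coe_smul, ← Complex.coe_smul, map_add, map_smul, map_smul]
      rfl
    change f (a • x + b • y) = a • f x + b • f y
    rw [h1, Complex.real_smul, Complex.real_smul]
  by_cases hmem : (fun f => ξ f) ∈ j '' T
  · obtain ⟨x, -, hx⟩ := hmem
    exact ⟨x, UniformConvergenceCLM.ext _ _ fun f => congr_fun hx f⟩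
  exfalso
  obtain ⟨φ, u, hφ, hu⟩ := RCLike.geometric_hahn_banach_closed_point (𝕜 := ℂ) hjT
    (hT.image hj).isClosed hmem
  obtain ⟨c, hc⟩ := exists_eq_sum_of_pi φ
  -- The finite combination of coordinates defining `φ` is itself a functional on `E`, and
  -- evaluating at it represents `φ` both on `T` and at `ξ`.
  let f : StarDual E := c.sum fun g a => a • g
  have hf : ∀ x, f x = φ (j x) := by
    intro x
    rw [hc]
    change PrimFrac.eval ℂ x f = _
    simp only [f, Finsupp.sum, map_sum, map_smul]
    rfl
  have hξf : ξ f = φ (fun f => ξ f) := by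
    rw [hc]
    simp only [f, Finsupp.sum, map_sum, map_smul]
    rfl
  have hT' : ∀ x ∈ T, |(f x).re| < u := by
    intro x hx
    rw [abs_lt]
    have h1 := hφ _ ⟨x, hx, rfl⟩
    have h2 := hφ _ ⟨-x, hT2.neg_mem_iff.2 hx, rfl⟩
    rw [← hf] at h1 h2
    rw [map_neg] at h2
    simp only [RCLike.re_to_complex, Complex.neg_re] at h1 h2
    exact ⟨by linarith, h1⟩
  have hu0 : 0 < u := (abs_nonneg _).trans_lt (hT' 0 (hST (Or.inr rfl)))
  have hSf : ∀ x ∈ S, ‖f x‖ ≤ r * u := by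
    intro x hx
    have h1 := hT' _ (hST (Or.inl (Or.inl ⟨x, hx, rfl⟩)))
    have h2 := hT' _ (hST (Or.inl (Or.inr ⟨x, hx, rfl⟩)))
    simp only [map_smul, smul_eq_mul] at h1 h2
    have e1 : (2 / r * f x : ℂ).re = 2 / r * (f x).re := by
      rw [show (2 / r * f x : ℂ) = ((2 / r : ℝ) : ℂ) * f x by push_cast; rfl, Complex.re_ofReal_mul]
    have e2 : (2 * Complex.I / r * f x : ℂ).re = -(2 / r * (f x).im) := by
      rw [show (2 * Complex.I / r * f x : ℂ) = ((2 / r : ℝ) : ℂ) * (Complex.I * f x) by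
        push_cast; ring, Complex.re_ofReal_mul]
      simp
    rw [e1, abs_mul, abs_of_pos (by positivity)] at h1
    rw [e2, abs_neg, abs_mul, abs_of_pos (by positivity)] at h2
    have h3 : 2 / r * ‖f x‖ ≤ 2 / r * |(f x).re| + 2 / r * |(f x).im| := by
      rw [← mul_add]
      exact mul_le_mul_of_nonneg_left (Complex.norm_le_abs_re_add_abs_im _) (by positivity)
    have h4 : 2 / r * ‖f x‖ ≤ 2 * u := by linarith
    rw [div_mul_eq_mul_div, div_le_iff₀ hr] at h4
    linarith
  have h5 : ‖ξ ((u : ℂ)⁻¹ • f)‖ ≤ 1 := by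
    refine hSr fun x hx => ?_
    rw [mem_closedBall_zero_iff]
    change ‖(u : ℂ)⁻¹ * f x‖ ≤ r
    rw [norm_mul, norm_inv, Complex.norm_real, Real.norm_of_nonneg hu0.le, inv_mul_le_iff₀ hu0,
      mul_comm u]
    exact hSf x hx
  rw [map_smul, norm_smul, norm_inv, Complex.norm_real, Real.norm_of_nonneg hu0.le,
    inv_mul_le_one₀ hu0, hξf] at h5
  exact (hu.trans_le (RCLike.re_le_norm _)).not_ge h5

/-- A Hausdorff pseudocomplete pseudosaturated locally convex space is stereotype. -/
theorem IsPseudosaturated.isStereotype [T2Space E] (h1 : IsPseudosaturated E)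
    (h2 : IsPseudocomplete E) : IsStereotype E := by
  have hinj : Function.Injective (bidual : E →ₗ[ℂ] StarDual (StarDual E)) := by
    refine (injective_iff_map_eq_zero _).2 fun x hx => ?_
    by_contra hne
    obtain ⟨f, hf⟩ := RCLike.geometric_hahn_banach_point_point (𝕜 := ℂ) hne
    have : bidual x f = 0 := by rw [hx]; rfl
    have h3 : f x = 0 := this
    simp [h3] at hf
  let e := LinearEquiv.ofBijective bidual ⟨hinj, bidual_surjective h2⟩
  refine ⟨⟨e, continuous_bidual h1, ?_⟩, fun _ _ => rfl⟩
  change Continuous e.symm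
  refine continuous_of_continuousAt_zero e.symm ?_
  rw [ContinuousAt, map_zero]
  refine Tendsto.mono_right ?_ comap_bidual_nhds_zero_le
  rw [tendsto_comap_iff]
  refine tendsto_id.congr fun ξ => (e.apply_symm_apply ξ).symm

end Stereotype

/-! ### Stabilization of the injective series. -/

section InjSeries

variable {E : Type u} [AddCommGroup E] [Module ℂ E] [TopologicalSpace E]
  [IsTopologicalAddGroup E] [ContinuousConstSMul ℂ E]

theorem injStep_mono {M N : Submodule ℂ E} (h : M ≤ N) : injStep M ≤ injStep N :=
  fun _ ⟨S, hS, h'⟩ => ⟨S, hS.trans h, h'⟩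

/-- The pseudocompletion is the smallest subspace stable under the step of the injective
series. -/
theorem injLimit_le {M N : Submodule ℂ E} (h1 : M ≤ N) (h2 : injStep N ≤ N) : injLimit M ≤ N := by
  refine iSup_le fun l => ?_
  induction l using Ordinal.limitRecOn with
  | zero => rwa [injSeries_zero]
  | add_one l ih => rw [injSeries_add_one]; exact (injStep_mono ih).trans h2
  | limit l hl ih => rw [injSeries_limit M l hl]; exact iSup_le fun κ => ih κ.1 κ.2

/-- The ordinals do not inject into the set of subspaces, so two terms of the series coincide, and
monotonicity makes the earlier one stable under the step. -/
theorem injStep_injLimit (M : Submodule ℂ E) : injStep (injLimit M) = injLimit M := by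
  have hni := not_injective_of_ordinal (injSeries M)
  rw [Function.Injective] at hni
  push Not at hni
  obtain ⟨a, b, hab, hne⟩ := hni
  wlog hlt : a < b generalizing a b
  · exact this b a hab.symm hne.symm (lt_of_le_of_ne (not_lt.1 hlt) hne.symm)
  have hstep : injStep (injSeries M a) ≤ injSeries M a := by
    rw [← injSeries_add_one]
    conv_rhs => rw [hab]
    exact injSeries_monotone M (Order.add_one_le_iff.2 hlt)
  have : injLimit M = injSeries M a := by
    refine le_antisymm (injLimit_le ?_ hstep) (le_iSup (injSeries M) a)
    conv_lhs => rw [← injSeries_zero M]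
    exact injSeries_monotone M zero_le
  rw [this]
  exact le_antisymm hstep (le_injStep _)

end InjSeries

/-! ### The completion and the extension of operators to it. -/

namespace LCCompletion

open UniformSpace

attribute [local instance] IsTopologicalAddGroup.rightUniformSpace isUniformAddGroup_of_addCommGroup
  uniformContinuousConstSMul_of_continuousConstSMul

variable (X : Type u) [AddCommGroup X] [Module ℂ X] [TopologicalSpace X]
  [IsTopologicalAddGroup X] [ContinuousSMul ℂ X]

instance : T2Space (LCCompletion X) := inferInstanceAs (T2Space (Completion X))

theorem isDenseInducing_coe : IsDenseInducing (coe X) :=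
  Completion.isDenseInducing_coe (α := X)

theorem exists_le_nhds (f : Filter (LCCompletion X)) (hne : f.NeBot)
    (hf : ∀ U ∈ 𝓝 (0 : LCCompletion X), ∃ A ∈ f, ∀ x ∈ A, ∀ y ∈ A, x - y ∈ U) :
    ∃ x, f ≤ 𝓝 x := by
  refine CompleteSpace.complete (α := Completion X) ?_
  refine IsUniformAddGroup.cauchy_iff_tendsto_swapped (G := Completion X) _ |>.2
    ⟨hne, fun U hU => ?_⟩
  obtain ⟨A, hA, hAU⟩ := hf U hU
  exact mem_prod_self_iff.2 ⟨A, hA, fun p hp => hAU _ hp.2 _ hp.1⟩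

variable {X}

/-- The extension of an operator to the completions. -/
noncomputable def map {Z : Type v} [AddCommGroup Z] [Module ℂ Z] [TopologicalSpace Z]
    [IsTopologicalAddGroup Z] [ContinuousSMul ℂ Z] (φ : X →L[ℂ] Z) :
    LCCompletion X →L[ℂ] LCCompletion Z :=
  (ContinuousLinearMap.completion φ : Completion X →L[ℂ] Completion Z)

theorem map_coe {Z : Type v} [AddCommGroup Z] [Module ℂ Z] [TopologicalSpace Z]
    [IsTopologicalAddGroup Z] [ContinuousSMul ℂ Z] (φ : X →L[ℂ] Z) (x : X) :
    map φ (coe X x) = coe Z (φ x) :=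
  ContinuousLinearMap.completion_apply_coe φ x

end LCCompletion

/-! ### The pseudocompletion: inherited properties and extension of operators. -/

namespace PsCompl

variable (X : Type u) [AddCommGroup X] [Module ℂ X] [TopologicalSpace X]
  [IsTopologicalAddGroup X] [ContinuousSMul ℂ X]

/-- The inclusion of the pseudocompletion in the completion. -/
noncomputable def incl : PsCompl X →L[ℂ] LCCompletion X := Submodule.subtypeL _

theorem isInducing_incl : IsInducing (incl X) := IsInducing.subtypeVal

theorem incl_injective : Function.Injective (incl X) := Subtype.val_injective

instance : T2Space (PsCompl X) :=
  T2Space.of_injective_continuous (incl_injective X) (incl X).continuous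

theorem isDenseInducing_ofBase : IsDenseInducing (ofBase X) where
  toIsInducing := (isInducing_incl X).of_comp_iff.1 (LCCompletion.isDenseInducing_coe X).toIsInducing
  dense := by
    intro x
    rw [(isInducing_incl X).closure_eq_preimage_closure_image, ← Set.range_comp]
    exact (LCCompletion.isDenseInducing_coe X).dense _

/-- The limit in the completion is adherent to a totally bounded subset of the stable subspace, so
one more step of the injective series would add it. -/
theorem isPseudocomplete : IsPseudocomplete (PsCompl X) := by
  refine isPseudocomplete_iff.2 fun f hne hf ⟨S, hSf, hS⟩ => ?_
  obtain ⟨y, hy⟩ := LCCompletion.exists_le_nhds X (Filter.map (incl X) f) inferInstance fun U hU => by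
    obtain ⟨A, hA, hAU⟩ := hf (incl X ⁻¹' U)
      ((incl X).continuous.continuousAt.preimage_mem_nhds (by simpa using hU))
    refine ⟨_, image_mem_map hA, ?_⟩
    rintro _ ⟨a, ha, rfl⟩ _ ⟨b, hb, rfl⟩
    simpa using hAU a ha b hb
  have hmem : y ∈ injLimit (LinearMap.range (LCCompletion.coe X : X →ₗ[ℂ] LCCompletion X)) := by
    rw [← injStep_injLimit]
    refine ⟨incl X '' S, ?_, hS.image (incl X : PsCompl X →+ LCCompletion X) (incl X).continuous, ?_⟩
    · rintro _ ⟨a, -, rfl⟩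
      exact a.2
    · exact mem_closure_of_tendsto (f := incl X) (b := f) hy
        (mem_of_superset hSf fun a ha => ⟨a, ha, rfl⟩)
  obtain ⟨z, rfl⟩ : ∃ z : PsCompl X, incl X z = y := ⟨⟨y, hmem⟩, rfl⟩
  refine ⟨z, ?_⟩
  rw [(isInducing_incl X).nhds_eq_comap]
  exact map_le_iff_le_comap.1 hy

/-- By density, closures of images of convex neighbourhoods in `X` are neighbourhoods; by regularity
they can be made arbitrarily small. -/
instance [LocallyConvexSpace ℝ X] : LocallyConvexSpace ℝ (PsCompl X) := by
  have : ContinuousSMul ℝ (PsCompl X) := IsScalarTower.continuousSMul ℂ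
  refine (locallyConvexSpace_iff_exists_convex_subset_zero ℝ (PsCompl X)).2 fun V hV => ?_
  obtain ⟨V', hV', hc, hV'V⟩ := exists_mem_nhds_isClosed_subset hV
  have hpre : ofBase X ⁻¹' V' ∈ 𝓝 0 :=
    (ofBase X).continuous.continuousAt.preimage_mem_nhds (by simpa using hV')
  obtain ⟨U, ⟨hU, hUc⟩, hUV⟩ := (LocallyConvexSpace.convex_basis_zero ℝ X).mem_iff.1 hpre
  refine ⟨closure (ofBase X '' U), ?_, ?_, ?_⟩
  · simpa using (isDenseInducing_ofBase X).closure_image_mem_nhds hU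
  · exact (hUc.linear_image ((ofBase X : X →ₗ[ℂ] PsCompl X).restrictScalars ℝ)).closure
  · exact (closure_minimal (Set.image_subset_iff.2 hUV) hc).trans hV'V

variable {X}

/-- The induction principle for the pseudocompletion: a subspace which contains `X` and the limits
of totally bounded nets of its elements is the whole space. -/
theorem induction (M : Submodule ℂ (PsCompl X)) (h1 : ∀ x, ofBase X x ∈ M)
    (h2 : ∀ S : Set (PsCompl X), S ⊆ M → IsTotBdd S → ∀ x ∈ closure S, x ∈ M) (x : PsCompl X) :
    x ∈ M := by
  suffices h : injLimit (LinearMap.range (LCCompletion.coe X : X →ₗ[ℂ] LCCompletion X)) ≤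
      M.map (incl X : PsCompl X →ₗ[ℂ] LCCompletion X) by
    obtain ⟨y, hy, hyx⟩ := h x.2
    rwa [incl_injective X (hyx : incl X y = incl X x)] at hy
  refine injLimit_le ?_ ?_
  · rintro _ ⟨y, rfl⟩
    exact ⟨ofBase X y, h1 y, rfl⟩
  · rintro y ⟨S, hSM, hS, hy⟩
    have hle : M.map (incl X : PsCompl X →ₗ[ℂ] LCCompletion X) ≤
        injLimit (LinearMap.range (LCCompletion.coe X : X →ₗ[ℂ] LCCompletion X)) := by
      rintro _ ⟨z, -, rfl⟩
      exact z.2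
    -- The point must first be known to lie in the pseudocompletion before the closure property of
    -- `M` can be applied to it.
    have hmem : y ∈ injLimit (LinearMap.range (LCCompletion.coe X : X →ₗ[ℂ] LCCompletion X)) := by
      rw [← injStep_injLimit]
      exact ⟨S, hSM.trans hle, hS, hy⟩
    let z : PsCompl X := (⟨y, hmem⟩ : injLimit _)
    have himg : incl X '' (incl X ⁻¹' S) = S := by
      refine Set.image_preimage_eq_of_subset fun s hs => ?_
      obtain ⟨z, -, rfl⟩ := hSM hs
      exact ⟨z, rfl⟩
    refine ⟨z, h2 (incl X ⁻¹' S) ?_ ?_ z ?_, rfl⟩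
    · intro s hs
      obtain ⟨z, hz, hzs⟩ := hSM hs
      rwa [incl_injective X (hzs : incl X z = incl X s)] at hz
    · exact hS.preimage (f := (incl X : PsCompl X →+ LCCompletion X)) (isInducing_incl X)
    · rw [(isInducing_incl X).closure_eq_preimage_closure_image, himg]
      exact hy

/-- The trace of `D` on `X` is again closed, convex, balanced and capacious, hence a neighbourhood;
the closure of its image is a neighbourhood by density and lies in `D`. -/
theorem isPseudosaturated [LocallyConvexSpace ℝ X] (hX : IsPseudosaturated X) :
    IsPseudosaturated (PsCompl X) := by
  intro D h0 h1 h2 h3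
  have hD : ofBase X ⁻¹' D ∈ 𝓝 0 := by
    refine hX _ (h0.preimage (ofBase X).continuous) ?_ ?_ ?_
    · intro x hx y hy a b ha hb hab
      have := h1 hx hy ha hb hab
      rw [← Complex.coe_smul, ← Complex.coe_smul] at this
      change ofBase X (a • x + b • y) ∈ D
      rw [← Complex.coe_smul, ← Complex.coe_smul, map_add, map_smul, map_smul]
      exact this
    · rintro c hc _ ⟨x, hx, rfl⟩
      have := h2 c hc ⟨_, hx, rfl⟩
      simpa using this
    · refine isCapacious_of_exists fun S hS => ?_
      -- The centres can be chosen in the image of `S`, so they come from points of `X`.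
      obtain ⟨G, -, hG, h⟩ := Set.exists_subset_image_finite_and.1
        (h3.exists_finite_subset h1 h2
          (hS.image (ofBase X : X →+ PsCompl X) (ofBase X).continuous))
      refine ⟨G, hG, fun x hx => ?_⟩
      obtain ⟨_, ⟨y, hy, rfl⟩, hxy⟩ := h _ ⟨x, hx, rfl⟩
      refine ⟨y, hy, ?_⟩
      change ofBase X (x - y) ∈ D
      rw [map_sub]
      exact hxy
  have := (isDenseInducing_ofBase X).closure_image_mem_nhds hD
  rw [map_zero] at this
  exact mem_of_superset this (closure_minimal (Set.image_preimage_subset _ _) h0)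

variable {Z : Type v} [AddCommGroup Z] [Module ℂ Z] [TopologicalSpace Z]
    [IsTopologicalAddGroup Z] [ContinuousSMul ℂ Z] [T2Space Z]

/-- Operators to a pseudocomplete space extend to the pseudocompletion. -/
theorem exists_extension (hZ : IsPseudocomplete Z) (φ : X →L[ℂ] Z) :
    ∃ ψ : PsCompl X →L[ℂ] Z, ∀ x, ψ (ofBase X x) = φ x := by
  let j := LCCompletion.coe Z
  have hj : IsInducing j := (LCCompletion.isDenseInducing_coe Z).toIsInducing
  have hinj : Function.Injective j := hj.injective
  let Φ : PsCompl X →L[ℂ] LCCompletion Z := (LCCompletion.map φ).comp (incl X)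
  have hΦ : ∀ x, Φ (ofBase X x) = j (φ x) := LCCompletion.map_coe φ
  -- The extension to the completions does not leave `Z`: this holds on `X`, and limits over totally
  -- bounded sets stay in `Z` by pseudocompleteness.
  have hmem : ∀ x, Φ x ∈ LinearMap.range (j : Z →ₗ[ℂ] LCCompletion Z) := by
    refine induction ((LinearMap.range (j : Z →ₗ[ℂ] LCCompletion Z)).comap
      (Φ : PsCompl X →ₗ[ℂ] LCCompletion Z)) (fun x => ⟨φ x, (hΦ x).symm⟩) fun S hS hSt x hx => ?_
    refine hZ.mem_range_of_mem_closure (f := (j : Z →+ LCCompletion Z)) hj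
      (hSt.image (Φ : PsCompl X →+ LCCompletion Z) Φ.continuous) ?_
      (map_mem_closure Φ.continuous hx fun s hs => ⟨s, hs, rfl⟩)
    rintro _ ⟨s, hs, rfl⟩
    exact hS hs
  choose g hg using hmem
  replace hg : ∀ x, j (g x) = Φ x := hg
  refine ⟨{ toFun := g, map_add' := fun x y => hinj ?_, map_smul' := fun c x => hinj ?_,
            cont := hj.continuous_iff.2 (Φ.continuous.congr fun x => (hg x).symm) }, fun x => hinj ?_⟩
  · simp [hg]
  · simp [hg]
  · exact (hg _).trans (hΦ x)

theorem ext_of_ofBase {φ ψ : PsCompl X →L[ℂ] Z} (h : ∀ x, φ (ofBase X x) = ψ (ofBase X x)) :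
    φ = ψ :=
  DFunLike.coe_injective ((isDenseInducing_ofBase X).dense.equalizer φ.continuous ψ.continuous
    (funext h))

end PsCompl

/-! ### Continuity of the extension of operators, and the isomorphism. -/

section

variable {X : Type u} {Y : Type v}
    [AddCommGroup X] [Module ℂ X] [TopologicalSpace X] [IsTopologicalAddGroup X]
    [ContinuousSMul ℂ X]
    [AddCommGroup Y] [Module ℂ Y] [TopologicalSpace Y] [IsTopologicalAddGroup Y]
    [ContinuousSMul ℂ Y] [LocallyConvexSpace ℝ Y]

/-- Totally bounded sets of operators to `Y` remain totally bounded as sets of operators to the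
pseudosaturation of `Y`. -/
theorem PrimFrac.isTotBdd_image_psSat {L : PrimFrac Y X → PrimFrac (PsSat Y) X}
    (hL : ∀ f x, L f x = PsSat.ofBase (f x)) {A : Set (PrimFrac Y X)} (hA : IsTotBdd A) :
    IsTotBdd (L '' A) := by
  refine isTotBdd_of_exists fun N hN => ?_
  obtain ⟨⟨T, U⟩, ⟨hT, hU⟩, hTU⟩ := (hasBasis_nhds_zero_of_basis
    (𝓝 (0 : PsSat Y)).basis_sets).mem_iff.1 hN
  have hK := isTotBdd_image2 hA hT
  -- All differences `f x - g x` lie in the totally bounded set `K - K`, where a neighbourhood of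
  -- `Y` already controls one of its pseudosaturation.
  obtain ⟨W, hW, hWU⟩ := PsSat.exists_nhds_of_isTotBdd (hK.sub hK) hU
  obtain ⟨A', hAA', hfin, h⟩ := hA.exists_finite_subset (mapsTo_mem_nhds hT hW)
  refine ⟨L '' A', hfin.image L, ?_⟩
  rintro _ ⟨f, hf, rfl⟩
  obtain ⟨g, hg, hfg⟩ := h f hf
  refine ⟨L g, ⟨g, hg, rfl⟩, hTU fun x hx => ?_⟩
  have := hWU (f x - g x) (Set.sub_mem_sub ⟨f, hf, x, hx, rfl⟩ ⟨g, hAA' hg, x, hx, rfl⟩) (hfg x hx)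
  rw [sub_apply, hL, hL, ← map_sub]
  exact this

variable [LocallyConvexSpace ℝ X]

/-- The operator from a pseudosaturated space `X` to the pseudosaturation of `Y` given by
an operator to `Y`. -/
noncomputable def PrimFrac.toPsSat (hX : IsPseudosaturated X) (f : PrimFrac Y X) : PrimFrac (PsSat Y) X :=
  ((PsSat.map (f : X →L[ℂ] Y)).comp (PsSat.ofPseudosaturated hX) : X →L[ℂ] PsSat Y)

theorem PrimFrac.toPsSat_apply (hX : IsPseudosaturated X) (f : PrimFrac Y X) (x : X) :
    toPsSat hX f x = PsSat.ofBase (f x) := rfl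

variable {G : PsSat (PrimFrac Y X) →ₗ[ℂ] PrimFrac (PsSat Y) (PsCompl X)}

/-- The extensions to the pseudocompletion of a totally bounded set of operators are
equicontinuous as operators to the pseudosaturation. -/
theorem setOf_forall_extension_mem_nhds (hX : IsPseudosaturated X)
    (hG : ∀ f x, G f (PsCompl.ofBase X x) = PsSat.ofBase (PsSat.toBase _ f x))
    {A : Set (PsSat (PrimFrac Y X))} (hA : IsTotBdd A) {U : Set (PsSat Y)} (hU : U ∈ 𝓝 0) :
    {x | ∀ f ∈ A, G f x ∈ U} ∈ 𝓝 0 := by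
  obtain ⟨V, hV, hc, hVU⟩ := exists_mem_nhds_isClosed_subset hU
  have hA' : IsTotBdd (PsSat.toBase _ '' A) :=
    hA.image (PsSat.toBase (PrimFrac Y X) : PsSat (PrimFrac Y X) →+ PrimFrac Y X)
      (PsSat.toBase _).continuous
  -- Equicontinuity is obtained on `X`, with values in `PsSat Y`, and then spread by density because
  -- `V` is closed.
  have hX' := PrimFrac.setOf_forall_mem_nhds hX
    (PrimFrac.isTotBdd_image_psSat (PrimFrac.toPsSat_apply hX) hA') hV
  have hcl : IsClosed {x | ∀ f ∈ A, G f x ∈ V} := by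
    simp only [Set.ofPred_forall]
    exact isClosed_biInter fun f _ => hc.preimage (map_continuous (G f))
  have := (PsCompl.isDenseInducing_ofBase X).closure_image_mem_nhds hX'
  rw [map_zero] at this
  refine mem_of_superset this ((closure_minimal ?_ hcl).trans fun x hx f hf => hVU (hx f hf))
  rintro _ ⟨x, hx, rfl⟩ f hf
  rw [hG]
  exact hx _ ⟨_, ⟨f, hf, rfl⟩, rfl⟩

/-- For a closed convex balanced bound, the set is a neighbourhood because the space of `f` is
pseudosaturated. Continuity of the evaluations on `S` gives closedness and pointwise total
boundedness; with equicontinuity of the extensions, Ascoli's argument gives capacity. -/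
theorem setOf_forall_mem_nhds_of_continuous (hX : IsPseudosaturated X)
    (hG : ∀ f x, G f (PsCompl.ofBase X x) = PsSat.ofBase (PsSat.toBase _ f x))
    {S : Set (PsCompl X)} (hS : IsTotBdd S) (hSc : ∀ x ∈ S, Continuous fun f => G f x)
    {U : Set (PsSat Y)} (hU : U ∈ 𝓝 0) : {f | ∀ x ∈ S, G f x ∈ U} ∈ 𝓝 0 := by
  obtain ⟨V, ⟨hV, h0, h1, h2⟩, hVU⟩ := hasBasis_nhds_zero_closed_convex_balanced.mem_iff.1 hU
  have hmem : {f | ∀ x ∈ S, G f x ∈ V} ∈ 𝓝 0 := by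
    refine PsSat.isPseudosaturated (E := PrimFrac Y X) _ ?_ ?_ ?_ ?_
    · simp only [Set.ofPred_forall]
      exact isClosed_biInter fun x hx => h0.preimage (hSc x hx)
    · intro f hf g hg a b ha hb hab x hx
      have := h1 (hf x hx) (hg x hx) ha hb hab
      rw [← Complex.coe_smul, ← Complex.coe_smul] at this
      rw [← Complex.coe_smul, ← Complex.coe_smul, map_add, map_smul, map_smul]
      exact this
    · rintro c hc _ ⟨f, hf, rfl⟩ x hx
      have := h2 c hc ⟨_, hf x hx, rfl⟩
      simp only [map_smul]
      exact this
    · refine isCapacious_of_exists fun A hA => ?_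
      let ev (x : PsCompl X) : PsSat (PrimFrac Y X) →ₗ[ℂ] PsSat Y :=
        (PrimFrac.eval (PsSat Y) x : PrimFrac (PsSat Y) (PsCompl X) →ₗ[ℂ] PsSat Y).comp G
      obtain ⟨A', -, hfin, h⟩ := PrimFrac.exists_finite_of_equicontinuous
        (fun f => (AddMonoidHomClass.toAddMonoidHom (G f) : PsCompl X →+ PsSat Y)) hS
        (fun U hU => setOf_forall_extension_mem_nhds hX hG hA hU)
        (fun x hx => hA.image (ev x).toAddMonoidHom (hSc x hx)) hV
      refine ⟨A', hfin, fun f hf => ?_⟩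
      obtain ⟨g, hg, hfg⟩ := h f hf
      refine ⟨g, hg, fun x hx => ?_⟩
      rw [map_sub]
      exact hfg x hx
  exact mem_of_superset hmem fun f hf x hx => hVU (hf x hx)

/-- The points with continuous evaluation form a subspace. It contains `X`, where evaluation is a
pseudosaturated operator, and it is stable under totally bounded limits: the uniform bound on `S` by
a closed set passes to the closure of `S`. -/
theorem continuous_extension_eval (hX : IsPseudosaturated X)
    (hG : ∀ f x, G f (PsCompl.ofBase X x) = PsSat.ofBase (PsSat.toBase _ f x)) (x : PsCompl X) :
    Continuous fun f => G f x := by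
  let M : Submodule ℂ (PsCompl X) :=
    { carrier := {x | Continuous fun f => G f x}
      add_mem' := fun {x y} hx hy => (hx.add hy).congr fun f => (map_add (G f) x y).symm
      zero_mem' := continuous_const.congr fun f => (map_zero (G f)).symm
      smul_mem' := fun c x hx => (hx.const_smul c).congr fun f => (map_smul (G f) c x).symm }
  refine PsCompl.induction M (fun x => ?_) (fun S hSM hS x hx => ?_) x
  · exact (PsSat.map (PrimFrac.eval Y x)).continuous.congr fun f => (hG f x).symm
  · let ev : PsSat (PrimFrac Y X) →ₗ[ℂ] PsSat Y :=
      (PrimFrac.eval (PsSat Y) x : PrimFrac (PsSat Y) (PsCompl X) →ₗ[ℂ] PsSat Y).comp G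
    refine continuous_of_continuousAt_zero ev ?_
    rw [ContinuousAt, map_zero]
    refine hasBasis_nhds_zero_closed_convex_balanced.ge_iff.2 fun U hU => ?_
    refine mem_map.2 (mem_of_superset
      (setOf_forall_mem_nhds_of_continuous hX hG hS (fun s hs => hSM hs) hU.1) fun f hf => ?_)
    exact closure_minimal (t := {x | G f x ∈ U}) hf
      (hU.2.1.preimage (map_continuous (G f))) hx

/-- The extension of operators to the pseudocompletion is continuous on the pseudosaturation of
the space of operators. -/
theorem continuous_extension (hX : IsPseudosaturated X)
    (hG : ∀ f x, G f (PsCompl.ofBase X x) = PsSat.ofBase (PsSat.toBase _ f x)) :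
    Continuous G := by
  refine continuous_of_continuousAt_zero G ?_
  rw [ContinuousAt, map_zero]
  refine (PrimFrac.hasBasis_nhds_zero_of_basis (𝓝 (0 : PsSat Y)).basis_sets).ge_iff.2 ?_
  rintro ⟨T, U⟩ ⟨hT, hU⟩
  exact mem_map.2 (setOf_forall_mem_nhds_of_continuous hX hG hT
    (fun x _ => continuous_extension_eval hX hG x) hU)

variable [T2Space Y]

/-- Injectivity is density of `X`; a preimage is found by lifting to `PsSat Y` and then extending.
-/
theorem PrimFrac.map_toBase_ofBase_bijective (hX : IsPseudosaturated X) (hY : IsPseudocomplete Y) :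
    Function.Bijective (PrimFrac.map (PsSat.toBase Y) (PsCompl.ofBase X)) := by
  constructor
  · intro f g hfg
    exact PsCompl.ext_of_ofBase (φ := f) (ψ := g) fun x =>
      PsSat.toBase_injective (DFunLike.congr_fun hfg x)
  · intro f
    obtain ⟨ψ, hψ⟩ := PsCompl.exists_extension hY.psSat (toPsSat hX f : X →L[ℂ] PsSat Y)
    refine ⟨ψ, UniformConvergenceCLM.ext _ _ fun x => ?_⟩
    exact congr_arg (PsSat.toBase Y) (hψ x)

theorem exists_psSat_map_equiv (hX : IsPseudosaturated X) (hY : IsPseudocomplete Y) :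
    ∃ e : SteFrac (PsSat Y) (PsCompl X) ≃L[ℂ] PsSat (PrimFrac Y X),
      (e : SteFrac (PsSat Y) (PsCompl X) →L[ℂ] PsSat (PrimFrac Y X)) =
        PsSat.map (PrimFrac.map (PsSat.toBase Y) (PsCompl.ofBase X)) := by
  let Φ := PrimFrac.map (PsSat.toBase Y) (PsCompl.ofBase X)
  let e := LinearEquiv.ofBijective (Φ : PrimFrac (PsSat Y) (PsCompl X) →ₗ[ℂ] PrimFrac Y X)
    (PrimFrac.map_toBase_ofBase_bijective hX hY)
  let G : PsSat (PrimFrac Y X) →ₗ[ℂ] PrimFrac (PsSat Y) (PsCompl X) :=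
    (e.symm : PrimFrac Y X →ₗ[ℂ] _).comp (PsSat.toBase (PrimFrac Y X) : _ →ₗ[ℂ] PrimFrac Y X)
  have hG : ∀ f x, G f (PsCompl.ofBase X x) = PsSat.ofBase (PsSat.toBase _ f x) := fun f x =>
    DFunLike.congr_fun (e.apply_symm_apply (PsSat.toBase _ f)) x
  let G' : PsSat (PrimFrac Y X) →L[ℂ] PrimFrac (PsSat Y) (PsCompl X) :=
    ⟨G, continuous_extension hX hG⟩
  -- The source is already pseudosaturated, so pseudosaturating `G'` refines only the target.
  let Ψ : PsSat (PrimFrac Y X) →L[ℂ] SteFrac (PsSat Y) (PsCompl X) :=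
    (PsSat.map G').comp (PsSat.ofPseudosaturated (PsSat.isPseudosaturated (E := PrimFrac Y X)))
  exact ⟨ContinuousLinearEquiv.equivOfInverse (PsSat.map Φ) Ψ (fun f => e.symm_apply_apply f)
    (fun f => e.apply_symm_apply f), rfl⟩

end

end Ster

theorem mainTheorem2 {X : Type*} {Y : Type*}
    [AddCommGroup X] [Module ℂ X] [TopologicalSpace X] [IsTopologicalAddGroup X]
    [ContinuousSMul ℂ X] [LocallyConvexSpace ℝ X] [T2Space X]
    [AddCommGroup Y] [Module ℂ Y] [TopologicalSpace Y] [IsTopologicalAddGroup Y]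
    [ContinuousSMul ℂ Y] [LocallyConvexSpace ℝ Y] [T2Space Y]
    (hX : IsPseudosaturated X) (hY : IsPseudocomplete Y) :
    IsStereotype (PsSat Y) ∧ IsStereotype (PsCompl X) ∧
    IsStereotype (SteFrac (PsSat Y) (PsCompl X)) ∧ IsStereotype (PsSat (PrimFrac Y X)) ∧
    ∃ e : SteFrac (PsSat Y) (PsCompl X) ≃L[ℂ] PsSat (PrimFrac Y X),
      (e : SteFrac (PsSat Y) (PsCompl X) →L[ℂ] PsSat (PrimFrac Y X)) =
        PsSat.map (PrimFrac.map (PsSat.toBase Y) (PsCompl.ofBase X)) :=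
  -- Each of the four spaces is pseudosaturated and pseudocomplete, which gives stereotypy.
  have hX' := PsCompl.isPseudosaturated hX
  ⟨PsSat.isPseudosaturated.isStereotype hY.psSat,
    hX'.isStereotype (PsCompl.isPseudocomplete X),
    PsSat.isPseudosaturated.isStereotype (PrimFrac.isPseudocomplete hX' hY.psSat).psSat,
    PsSat.isPseudosaturated.isStereotype (PrimFrac.isPseudocomplete hX hY).psSat,
    exists_psSat_map_equiv hX hY⟩
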